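/- Let $F:\mathbb{R}^2\to[0,+\infty)$ be positively $1$-homogeneous ($F(tv)=tF(v)$ for $t>0$), and smooth and positive away from the origin. On $\mathbb{R}^4$ with coordinates $(x_1,y_1,x_2,y_2)$ and $r_j^2=x_j^2+y_j^2$, let $W=\{F(r_1^2,r_2^2)\le 1\}$ be the associated Reinhardt (toric) domain, and let $\lambda_0=\tfrac12\sum_{j=1}^2(x_j\,dy_j-y_j\,dx_j)$, which restricts to a contact form on $\partial W\simeq S^3$; orient $\partial W$ by $\lambda_0\wedge d\lambda_0$. The Reeb vector field $X$ on $\partial W$ is determined by $\lambda_0(X)=1$ and $d\lambda_0(X,\cdot)|_{T\partial W}=0$. A periodic orbit $\gamma$ is a periodic trajectory of $X$ together with one of its positive (not necessarily primitive) periods $T(\gamma)$. For two periodic orbits $\gamma_1,\gamma_2$ that are geometrically distinct (have different images) put $$\rho(\gamma_1,\gamma_2)=\frac{\mathrm{link}(\gamma_1,\gamma_2)\,\mathrm{vol}(\lambda_0)}{T(\gamma_1)\,T(\gamma_2)},\qquad \mathrm{vol}(\lambda_0)=\int_{\partial W}\lambda_0\wedge d\lambda_0,$$ where $\mathrm{link}$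 is the linking number in $\partial W\simeq S^3$, and let $\rho_-$ and $\rho_+$ be the infimum and the supremum of $\rho(\gamma_1,\gamma_2)$ over all pairs of geometrically distinct periodic orbits. Then $$\rho_-\le 1\le\rho_+ .$$ Moreover, the systolic norm $\rho_+-\rho_-$ vanishes if and only if $W$ is an ellipsoid, that is, $W=\{Q\le 1\}$ for some positive definite quadratic form $Q$ on $\mathbb{R}^4$. -/

import Mathlib

open scoped ContDiff

noncomputable section

namespace Reinhardt

/-- `ℝ⁴` with its Euclidean structure and coordinates `(x₁, y₁, x₂, y₂) = (p 0, p 1, p 2, p 3)`. -/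
abbrev R4 : Type := EuclideanSpace ℝ (Fin 4)

/-- The function `H = F(r₁², r₂²)` on `ℝ⁴`, where `r_j² = x_j² + y_j²`. -/
def toricFunction (F : ℝ × ℝ → ℝ) (p : R4) : ℝ :=
  F (p 0 ^ 2 + p 1 ^ 2, p 2 ^ 2 + p 3 ^ 2)

/-- The domain `W = {H ≤ 1}`. -/
def domain (H : R4 → ℝ) : Set R4 := {p | H p ≤ 1}

/-- The Liouville form
`λ₀ = ½ ∑ r_j² dθ_j = ½ ∑ (x_j dy_j - y_j dx_j)`, at the point `p` on the vector `v`. -/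
def liouville (p v : R4) : ℝ :=
  (1 / 2) * (p 0 * v 1 - p 1 * v 0 + (p 2 * v 3 - p 3 * v 2))

/-- The standard symplectic form
`ω₀ = dλ₀ = ∑ r_j dr_j ∧ dθ_j = ∑ dx_j ∧ dy_j`. -/
def symplectic (u v : R4) : ℝ :=
  u 0 * v 1 - u 1 * v 0 + (u 2 * v 3 - u 3 * v 2)

/-- `ω₀` is the exterior derivative of `λ₀`. -/
theorem symplectic_eq_dliouville (p u v : R4) :
    symplectic u v =
      fderiv ℝ (fun q : R4 => liouville q v) p u - fderiv ℝ (fun q : R4 => liouville q u) p v := by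
  have key : ∀ a b : R4, fderiv ℝ (fun q : R4 => liouville q a) p b = liouville b a := by
    intro a b
    let L : R4 →ₗ[ℝ] ℝ :=
      { toFun := fun q => liouville q a
        map_add' := fun x y => by simp only [liouville, PiLp.add_apply]; ring
        map_smul' := fun c x => by
          simp only [liouville, PiLp.smul_apply, smul_eq_mul, RingHom.id_apply]; ring }
    have h := (LinearMap.toContinuousLinearMap L).hasFDerivAt (x := p)
    have h2 : fderiv ℝ (fun q : R4 => liouville q a) p = LinearMap.toContinuousLinearMap L :=
      h.fderiv
    rw [h2]
    rfl
  rw [key, key]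
  simp only [liouville, symplectic]
  ring

/-- The 3-form `λ₀ ∧ dλ₀` at the point `p` on the vectors `u, v, w`. -/
def liouvilleWedge (p u v w : R4) : ℝ :=
  liouville p u * symplectic v w + liouville p v * symplectic w u + liouville p w * symplectic u v

/-- `v` is the Reeb vector at `p` of the restriction of `λ₀` to the level set of `H` through `p`:
it is tangent to the level set, `λ₀(v) = 1`, and `dλ₀(v, ·)` vanishes on the tangent space. -/
def IsReebVector (H : R4 → ℝ) (p v : R4) : Prop :=
  fderiv ℝ H p v = 0 ∧ liouville p v = 1 ∧ ∀ w : R4, fderiv ℝ H p w = 0 → symplectic v w = 0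

/-- A periodic Reeb orbit on `(∂W, λ₀)`: a periodic Reeb trajectory together with one of its
positive periods, which need not be the primitive one. -/
structure PeriodicOrbit (H : R4 → ℝ) where
  /-- the trajectory -/
  curve : ℝ → R4
  /-- the chosen period -/
  period : ℝ
  period_pos : 0 < period
  mem_boundary : ∀ t, curve t ∈ frontier (domain H)
  reeb : ∀ t, ∃ v, IsReebVector H (curve t) v ∧ HasDerivAt curve v t
  periodic : Function.Periodic curve period

/-- Two periodic orbits are geometrically distinct if they trace different subsets of `∂W`. -/
def GeomDistinct {H : R4 → ℝ} (γ₁ γ₂ : PeriodicOrbit H) : Prop :=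
  Set.range γ₁.curve ≠ Set.range γ₂.curve

/-- The solid angle form on `ℝ⁴ \ {0}`: the pullback of the normalised volume form of the
unit sphere `S³` (of total volume `2π²`) under `x ↦ x / ‖x‖`. -/
def directionForm (x u v w : R4) : ℝ :=
  Matrix.det (Matrix.of ![⇑x, ⇑u, ⇑v, ⇑w]) / (2 * Real.pi ^ 2 * ‖x‖ ^ 4)

/-- The map `(s, u, t) ↦ cos u · c₁(s) - sin u · c₂(t)`, `0 ≤ u ≤ π/2`. If no point of `c₁` is a
positive multiple of a point of `c₂`, it takes values in `ℝ⁴ \ {0}`. -/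
def joinMap (c₁ c₂ : ℝ → R4) (s u t : ℝ) : R4 :=
  Real.cos u • c₁ s - Real.sin u • c₂ t

/-- The linking number of the closed curves `c₁ : ℝ/T₁ℤ → S` and `c₂ : ℝ/T₂ℤ → S` in a
hypersurface `S ≅ S³` of `ℝ⁴` that is star-shaped about the origin (oriented as the boundary of the
domain it encloses), given by Gauss's integral on the 3-sphere: the degree of
`joinMap c₁ c₂ / ‖joinMap c₁ c₂‖` as a map from the join `S¹ * S¹ ≅ S³` to `S³`.
Equivalently, it is the algebraic intersection number of `c₁` with the disc that is the
cone over `c₂` with apex at a generic point. The Hopf link, made of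
`(e^{is}, 0)` and `(0, e^{it})` in `ℂ²`, has linking number `1`. -/
def linkingNumber (c₁ c₂ : ℝ → R4) (T₁ T₂ : ℝ) : ℝ :=
  ∫ s in (0 : ℝ)..T₁, ∫ t in (0 : ℝ)..T₂, ∫ u in (0 : ℝ)..(Real.pi / 2),
    directionForm (joinMap c₁ c₂ s u t)
      (deriv (fun s' => joinMap c₁ c₂ s' u t) s)
      (deriv (fun u' => joinMap c₁ c₂ s u' t) u)
      (deriv (fun t' => joinMap c₁ c₂ s u t') t)

/-- The radial diffeomorphism `S³ → ∂W`, `x ↦ x / √H(x)`, for `H` positively homogeneous of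
degree two and positive away from the origin. -/
def radial (H : R4 → ℝ) (x : R4) : R4 := (Real.sqrt (H x))⁻¹ • x

/-- The frame `e₁, e₂, e₃` of the tangent spaces of `S³`; at every `x ∈ S³` it is orthonormal and
`(x, e₁, e₂, e₃)` is positively oriented. -/
def frame₁ (x : R4) : R4 := !₂[-x 1, x 0, -x 3, x 2]

/-- The second vector of the frame. -/
def frame₂ (x : R4) : R4 := !₂[-x 2, x 3, x 0, -x 1]

/-- The third vector of the frame. -/
def frame₃ (x : R4) : R4 := !₂[-x 3, -x 2, x 1, x 0]

/-- The contact volume `vol(λ₀) = ∫_{∂W} λ₀ ∧ dλ₀`, computed as the integral over `S³` of the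
pullback of `λ₀ ∧ dλ₀` by the radial diffeomorphism `S³ → ∂W`. -/
def contactVolume (H : R4 → ℝ) : ℝ :=
  ∫ x : Metric.sphere (0 : R4) 1,
    liouvilleWedge (radial H x)
      (fderiv ℝ (radial H) x (frame₁ x))
      (fderiv ℝ (radial H) x (frame₂ x))
      (fderiv ℝ (radial H) x (frame₃ x))
    ∂(MeasureTheory.volume : MeasureTheory.Measure R4).toSphere

/-- The systolic pairing `ρ(γ₁, γ₂) = link(γ₁, γ₂) vol(λ₀) / (T(γ₁) T(γ₂))`. -/
def systolicPairing {H : R4 → ℝ} (γ₁ γ₂ : PeriodicOrbit H) : ℝ :=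
  linkingNumber γ₁.curve γ₂.curve γ₁.period γ₂.period * contactVolume H /
    (γ₁.period * γ₂.period)

/-- `ρ₋`, the infimum (in the extended reals) of the systolic pairing over all pairs of
geometrically distinct periodic orbits. -/
def rhoMinus (H : R4 → ℝ) : EReal :=
  ⨅ (γ₁ : PeriodicOrbit H) (γ₂ : PeriodicOrbit H) (_ : GeomDistinct γ₁ γ₂),
    (systolicPairing γ₁ γ₂ : EReal)

/-- `ρ₊`, the supremum (in the extended reals) of the systolic pairing over all pairs of
geometrically distinct periodic orbits. -/
def rhoPlus (H : R4 → ℝ) : EReal :=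
  ⨆ (γ₁ : PeriodicOrbit H) (γ₂ : PeriodicOrbit H) (_ : GeomDistinct γ₁ γ₂),
    (systolicPairing γ₁ γ₂ : EReal)

/-- The systolic norm `ρ₊ - ρ₋`. -/
def systolicNorm (H : R4 → ℝ) : EReal := rhoPlus H - rhoMinus H

/-- `W` is a (solid) ellipsoid centred at the origin: `W = {Q ≤ 1}` for a positive definite
quadratic form `Q`. -/
def IsEllipsoid (W : Set R4) : Prop :=
  ∃ Q : QuadraticForm ℝ R4, Q.PosDef ∧ W = {p | Q p ≤ 1}

end Reinhardt

end

noncomputable section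

namespace Reinhardt

open Set MeasureTheory Filter Topology
open scoped ENNReal

/-! Put `g m = F (1, m)` and `V = ∫₀^∞ dm / g²`. The contact volume is `π² V`, and the circle in the
plane `z₂ = 0`, paired with a closed orbit on the torus `r₂² = m r₁²`, has `ρ = g'(m) g(0) V`. Since
`g → ∞`, the integral of `g' / g²` over the half-line is `1 / g(0)`. So `ρ`, as a function of `m`,
has mean `1` for the weight `1 / (V g²)`, and the slope `g'` has mean `c = 1 / (g(0) V)`.

If `g'` is not constant, it takes values on both sides of `c`. On each side there are points with
`g'' ≠ 0`; near them the frequency ratio `(g - m g') / g'` varies, hence is rational somewhere, and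
that torus carries closed orbits (`affine_or_exists_resonant`). This gives `ρ₋ < 1 < ρ₊` from these
pairs alone (`exists_systolicPairing_eq`). If `g'` is constant, `F` is linear on the quadrant, the
Reeb flow is linear and every pair has `ρ = 1` (`systolicPairing_ellipsoid`). Conversely, an
ellipsoidal `W` has affine `g` on the positive half-line (`exists_slope_of_isEllipsoid`), which
excludes the first case.

The linking number is computed when both curves are, up to constant speed, orbits of one rotation:
the solid angle form contracted with its generator is exact, and Stokes' theorem leaves a line
integral (`linkingNumber_eq`). The volume formula comes from evaluating `∫ exp (-H)` over `ℝ⁴` in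
two ways (`contactVolume_toricFunction`). -/

/-- A curve in `ℝ⁴` may be differentiated coordinate by coordinate. -/
theorem hasDerivAt_R4 {c : ℝ → R4} {c' : R4} {s : ℝ} :
    HasDerivAt c c' s ↔ ∀ i, HasDerivAt (fun t => c t i) (c' i) s := by
  simp only [hasDerivAt_iff_hasFDerivAt, ← hasFDerivWithinAt_univ]
  rw [hasFDerivWithinAt_euclidean]
  refine forall_congr' fun i => ?_
  have : (PiLp.proj 2 (fun _ : Fin 4 => ℝ) i).comp (ContinuousLinearMap.toSpanSingleton ℝ c') =
      ContinuousLinearMap.toSpanSingleton ℝ (c' i) := by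
    ext; simp
  rw [← this]

/-! ### Rotations of the coordinate planes and their orbits. -/

/-- The infinitesimal generator of the rotation with angular velocities `a`, `b` in the two
coordinate planes. -/
def rotGen (a b : ℝ) (v : R4) : R4 := !₂[-(a * v 1), a * v 0, -(b * v 3), b * v 2]

/-- The trajectory of `p` under the rotation with angular velocities `a`, `b`. -/
def torusCurve (a b : ℝ) (p : R4) (t : ℝ) : R4 :=
  !₂[Real.cos (a * t) * p 0 - Real.sin (a * t) * p 1, Real.sin (a * t) * p 0 + Real.cos (a * t) * p 1,
    Real.cos (b * t) * p 2 - Real.sin (b * t) * p 3, Real.sin (b * t) * p 2 + Real.cos (b * t) * p 3]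

theorem hasDerivAt_torusCurve (a b : ℝ) (p : R4) (t : ℝ) :
    HasDerivAt (torusCurve a b p) (rotGen a b (torusCurve a b p t)) t := by
  rw [hasDerivAt_R4]
  have hs : ∀ k : ℝ, HasDerivAt (fun t => Real.sin (k * t)) (Real.cos (k * t) * k) t := fun k => by
    simpa using ((hasDerivAt_id t).const_mul k).sin
  have hc : ∀ k : ℝ, HasDerivAt (fun t => Real.cos (k * t)) (-Real.sin (k * t) * k) t := fun k => by
    simpa using ((hasDerivAt_id t).const_mul k).cos
  intro i
  fin_cases i <;> simp only [torusCurve, rotGen, Fin.isValue, Fin.zero_eta, Fin.mk_one, Fin.reduceFinMk]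
  · exact (((hc a).mul_const _).sub ((hs a).mul_const _)).congr_deriv (by simp; ring)
  · exact (((hs a).mul_const _).add ((hc a).mul_const _)).congr_deriv (by simp; ring)
  · exact (((hc b).mul_const _).sub ((hs b).mul_const _)).congr_deriv (by simp; ring)
  · exact (((hs b).mul_const _).add ((hc b).mul_const _)).congr_deriv (by simp; ring)

theorem continuous_torusCurve (a b : ℝ) (p : R4) : Continuous (torusCurve a b p) :=
  continuous_iff_continuousAt.2 fun t => (hasDerivAt_torusCurve a b p t).continuousAt

/-! ### Linking numbers: the Gauss integrand contracted with a rotation, and Stokes' theorem. -/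

/-- The bilinear form `b (dx₁ ∧ dy₁) + a (dx₂ ∧ dy₂)`. -/
def wedge (a b : ℝ) (v w : R4) : ℝ := b * (v 0 * w 1 - v 1 * w 0) + a * (v 2 * w 3 - v 3 * w 2)

/-- The Euclidean inner product, in coordinates. -/
def dot (v w : R4) : ℝ := v 0 * w 0 + v 1 * w 1 + v 2 * w 2 + v 3 * w 3

theorem dot_self (v : R4) : dot v v = ‖v‖ ^ 2 := by
  rw [EuclideanSpace.norm_sq_eq]; simp [Fin.sum_univ_four, dot]; ring

theorem dot_self_pos {v : R4} (hv : v ≠ 0) : 0 < dot v v := by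
  rw [dot_self]; positivity

/-- Divided by `|x|⁴`, the right side is `½ d(wedge x dx / |x|²)` on `v, w`. This exactness makes
the Gauss integral computable. -/
theorem det_rotGen (a b : ℝ) (x v w : R4) :
    Matrix.det (Matrix.of ![⇑x, ⇑v, ⇑w, ⇑(rotGen a b x)]) =
      dot x x * wedge a b v w - (dot x v * wedge a b x w - dot x w * wedge a b x v) := by
  simp [Matrix.det_succ_row_zero, Fin.sum_univ_succ, rotGen, Fin.succAbove, dot, wedge]
  ring

theorem directionForm_rotGen (a b : ℝ) (x v w : R4) :
    directionForm x v w (rotGen a b x) =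
      (dot x x * wedge a b v w - (dot x v * wedge a b x w - dot x w * wedge a b x v)) /
        (2 * Real.pi ^ 2 * dot x x ^ 2) := by
  rw [directionForm, det_rotGen, dot_self]; ring

theorem hasDerivAt_wedge (a b : ℝ) {f g : ℝ → R4} {f' g' : R4} {s : ℝ} (hf : HasDerivAt f f' s)
    (hg : HasDerivAt g g' s) :
    HasDerivAt (fun t => wedge a b (f t) (g t)) (wedge a b f' (g s) + wedge a b (f s) g') s := by
  rw [hasDerivAt_R4] at hf hg
  refine (((((hf 0).mul (hg 1)).sub ((hf 1).mul (hg 0))).const_mul b).add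
    ((((hf 2).mul (hg 3)).sub ((hf 3).mul (hg 2))).const_mul a)).congr_deriv ?_
  simp only [wedge]; ring

theorem hasDerivAt_dot {f g : ℝ → R4} {f' g' : R4} {s : ℝ} (hf : HasDerivAt f f' s)
    (hg : HasDerivAt g g' s) :
    HasDerivAt (fun t => dot (f t) (g t)) (dot f' (g s) + dot (f s) g') s := by
  rw [hasDerivAt_R4] at hf hg
  refine (((((hf 0).mul (hg 0)).add ((hf 1).mul (hg 1))).add ((hf 2).mul (hg 2))).add
    ((hf 3).mul (hg 3))).congr_deriv ?_
  simp only [dot]; ring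

theorem Continuous.wedge {X : Type*} [TopologicalSpace X] (a b : ℝ) {f g : X → R4}
    (hf : Continuous f) (hg : Continuous g) : Continuous fun x => wedge a b (f x) (g x) := by
  unfold Reinhardt.wedge; fun_prop

theorem Continuous.dot {X : Type*} [TopologicalSpace X] {f g : X → R4}
    (hf : Continuous f) (hg : Continuous g) : Continuous fun x => dot (f x) (g x) := by
  unfold Reinhardt.dot; fun_prop

/-- The interpolation `cos u · c - sin u · q` in the definition of the join. -/
def joinPt (c q : R4) (u : ℝ) : R4 := Real.cos u • c - Real.sin u • q

/-- The `u`-derivative of `joinPt`. -/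
def joinVel (c q : R4) (u : ℝ) : R4 := -Real.sin u • c - Real.cos u • q

theorem hasDerivAt_joinPt (c q : R4) (u : ℝ) : HasDerivAt (joinPt c q) (joinVel c q u) u := by
  exact ((Real.hasDerivAt_cos u).smul_const c).sub ((Real.hasDerivAt_sin u).smul_const q)

/-- The density of the exact form `½ d(wedge x dx / |x|²)`. -/
def exactDensity (a b : ℝ) (x v w : R4) : ℝ :=
  (dot x x * wedge a b v w - (dot x v * wedge a b x w - dot x w * wedge a b x v)) / dot x x ^ 2

theorem continuousOn_exactDensity {X : Type*} [TopologicalSpace X] (a b : ℝ) {x v w : X → R4}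
    {s : Set X} (hx : Continuous x) (hv : Continuous v) (hw : Continuous w)
    (h0 : ∀ z ∈ s, x z ≠ 0) : ContinuousOn (fun z => exactDensity a b (x z) (v z) (w z)) s := by
  refine ContinuousOn.div (Continuous.continuousOn ?_) (Continuous.continuousOn ?_) ?_
  · exact ((Continuous.dot hx hx).mul (Continuous.wedge a b hv hw)).sub
      (((Continuous.dot hx hv).mul (Continuous.wedge a b hx hw)).sub
        ((Continuous.dot hx hw).mul (Continuous.wedge a b hx hv)))
  · exact (Continuous.dot hx hx).pow 2
  · exact fun z hz => pow_ne_zero 2 (dot_self_pos (h0 z hz)).ne'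

/-- Stokes' theorem on the cone-like annulus swept out by a closed curve `c` and a point `q`. -/
theorem integral_exactDensity (a b : ℝ) {c c' : ℝ → R4} {q : R4} {T : ℝ} (hT : 0 ≤ T)
    (hc : ∀ s, HasDerivAt c (c' s) s) (hc' : Continuous c') (hper : Function.Periodic c T)
    (h0 : ∀ s, ∀ u ∈ Icc 0 (Real.pi / 2), joinPt (c s) q u ≠ 0) :
    ∫ s in (0 : ℝ)..T, ∫ u in (0 : ℝ)..(Real.pi / 2),
        exactDensity a b (joinPt (c s) q u) (Real.cos u • c' s) (joinVel (c s) q u) =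
      (1 / 2) * ∫ s in (0 : ℝ)..T, wedge a b (c s) (c' s) / dot (c s) (c s) := by
  have hpi : (0 : ℝ) ≤ Real.pi / 2 := by positivity
  have hcc : Continuous c := continuous_iff_continuousAt.2 fun s => (hc s).continuousAt
  have hX : Continuous fun z : ℝ × ℝ => joinPt (c z.1) q z.2 := by unfold joinPt; fun_prop
  have hV : Continuous fun z : ℝ × ℝ => Real.cos z.2 • c' z.1 := by fun_prop
  have hW : Continuous fun z : ℝ × ℝ => joinVel (c z.1) q z.2 := by unfold joinVel; fun_prop
  have hU : Continuous fun z : ℝ × ℝ => -Real.sin z.2 • c' z.1 := by fun_prop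
  have hne : ∀ z ∈ (univ ×ˢ Icc 0 (Real.pi / 2) : Set (ℝ × ℝ)), joinPt (c z.1) q z.2 ≠ 0 :=
    fun z hz => h0 _ _ hz.2
  -- `P` and `Q` are the `u`- and `s`-components of the pulled back 1-form `wedge x dx / |x|²`; `P'`
  -- and `Q'` are their cross derivatives, so the density is `½ (P' - Q')`.
  set P : ℝ → ℝ → ℝ := fun s u =>
    wedge a b (joinPt (c s) q u) (joinVel (c s) q u) / dot (joinPt (c s) q u) (joinPt (c s) q u)
    with hP
  set Q : ℝ → ℝ → ℝ := fun s u =>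
    wedge a b (joinPt (c s) q u) (Real.cos u • c' s) / dot (joinPt (c s) q u) (joinPt (c s) q u)
    with hQ
  set P' : ℝ → ℝ → ℝ := fun s u =>
    ((wedge a b (Real.cos u • c' s) (joinVel (c s) q u) +
      wedge a b (joinPt (c s) q u) (-Real.sin u • c' s)) *
      dot (joinPt (c s) q u) (joinPt (c s) q u) -
      wedge a b (joinPt (c s) q u) (joinVel (c s) q u) *
      (dot (Real.cos u • c' s) (joinPt (c s) q u) + dot (joinPt (c s) q u) (Real.cos u • c' s))) /
      dot (joinPt (c s) q u) (joinPt (c s) q u) ^ 2 with hP'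
  set Q' : ℝ → ℝ → ℝ := fun s u =>
    ((wedge a b (joinVel (c s) q u) (Real.cos u • c' s) +
      wedge a b (joinPt (c s) q u) (-Real.sin u • c' s)) *
      dot (joinPt (c s) q u) (joinPt (c s) q u) -
      wedge a b (joinPt (c s) q u) (Real.cos u • c' s) *
      (dot (joinVel (c s) q u) (joinPt (c s) q u) + dot (joinPt (c s) q u) (joinVel (c s) q u))) /
      dot (joinPt (c s) q u) (joinPt (c s) q u) ^ 2 with hQ'
  have hPd : ∀ s, ∀ u ∈ Icc 0 (Real.pi / 2), HasDerivAt (fun s => P s u) (P' s u) s := by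
    intro s u hu
    have hx : HasDerivAt (fun s => joinPt (c s) q u) (Real.cos u • c' s) s :=
      ((hc s).const_smul (Real.cos u)).sub_const (Real.sin u • q)
    have hw : HasDerivAt (fun s => joinVel (c s) q u) (-Real.sin u • c' s) s :=
      ((hc s).const_smul (-Real.sin u)).sub_const (Real.cos u • q)
    exact (hasDerivAt_wedge a b hx hw).div (hasDerivAt_dot hx hx) (dot_self_pos (h0 s u hu)).ne'
  have hQd : ∀ s, ∀ u ∈ Icc 0 (Real.pi / 2), HasDerivAt (fun u => Q s u) (Q' s u) u := by
    intro s u hu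
    have hx := hasDerivAt_joinPt (c s) q u
    have hv : HasDerivAt (fun u => Real.cos u • c' s) (-Real.sin u • c' s) u :=
      (Real.hasDerivAt_cos u).smul_const _
    exact (hasDerivAt_wedge a b hx hv).div (hasDerivAt_dot hx hx) (dot_self_pos (h0 s u hu)).ne'
  have hP'c : ContinuousOn P'.uncurry (univ ×ˢ Icc 0 (Real.pi / 2)) := by
    refine ContinuousOn.div (Continuous.continuousOn ?_) (Continuous.continuousOn ?_) ?_
    · exact (((Continuous.wedge a b hV hW).add (Continuous.wedge a b hX hU)).mul
        (Continuous.dot hX hX)).sub ((Continuous.wedge a b hX hW).mul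
          ((Continuous.dot hV hX).add (Continuous.dot hX hV)))
    · exact (Continuous.dot hX hX).pow 2
    · exact fun z hz => pow_ne_zero 2 (dot_self_pos (hne z hz)).ne'
  have hQ'c : ContinuousOn Q'.uncurry (univ ×ˢ Icc 0 (Real.pi / 2)) := by
    refine ContinuousOn.div (Continuous.continuousOn ?_) (Continuous.continuousOn ?_) ?_
    · exact (((Continuous.wedge a b hW hV).add (Continuous.wedge a b hX hU)).mul
        (Continuous.dot hX hX)).sub ((Continuous.wedge a b hX hV).mul
          ((Continuous.dot hW hX).add (Continuous.dot hX hW)))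
    · exact (Continuous.dot hX hX).pow 2
    · exact fun z hz => pow_ne_zero 2 (dot_self_pos (hne z hz)).ne'
  have hkey : ∀ s, ∀ u ∈ Icc 0 (Real.pi / 2),
      exactDensity a b (joinPt (c s) q u) (Real.cos u • c' s) (joinVel (c s) q u) =
        (1 / 2) * (P' s u - Q' s u) := by
    intro s u hu
    have h := (dot_self_pos (h0 s u hu)).ne'
    simp only [hP', hQ', exactDensity]
    generalize joinPt (c s) q u = x at *
    generalize joinVel (c s) q u = w at *
    generalize Real.cos u • c' s = v at *
    rw [← sub_div, ← mul_div_assoc]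
    congr 1
    simp only [dot, wedge]; ring
  -- Only the end `u = 0` contributes: at `u = π / 2` the `s`-velocity `cos u • c'` vanishes, the
  -- annulus being collapsed to the point `-q`.
  have hQs : ∀ s, ∫ u in (0 : ℝ)..(Real.pi / 2), Q' s u =
      -(wedge a b (c s) (c' s) / dot (c s) (c s)) := by
    intro s
    rw [intervalIntegral.integral_eq_sub_of_hasDerivAt (f := Q s)]
    · simp [hQ, joinPt, wedge]
    · rw [uIcc_of_le hpi]; exact hQd s
    · refine ContinuousOn.intervalIntegrable ?_
      rw [uIcc_of_le hpi]
      exact hQ'c.comp (f := fun u => (s, u)) (by fun_prop) fun u hu => ⟨trivial, hu⟩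
  have hPu : ∀ u ∈ Icc 0 (Real.pi / 2), ∫ s in (0 : ℝ)..T, P' s u = 0 := by
    intro u hu
    rw [intervalIntegral.integral_eq_sub_of_hasDerivAt (f := fun s => P s u)]
    · have : c T = c 0 := by simpa using hper 0
      simp [hP, this]
    · exact fun s _ => hPd s u hu
    · refine ContinuousOn.intervalIntegrable ?_
      exact hP'c.comp (f := fun s => (s, u)) (by fun_prop) fun s _ => ⟨trivial, hu⟩
  have hPs : ∀ s, IntervalIntegrable (P' s) volume 0 (Real.pi / 2) := fun s => by
    refine ContinuousOn.intervalIntegrable ?_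
    rw [uIcc_of_le hpi]
    exact hP'c.comp (f := fun u => (s, u)) (by fun_prop) fun u hu => ⟨trivial, hu⟩
  have hQs' : ∀ s, IntervalIntegrable (Q' s) volume 0 (Real.pi / 2) := fun s => by
    refine ContinuousOn.intervalIntegrable ?_
    rw [uIcc_of_le hpi]
    exact hQ'c.comp (f := fun u => (s, u)) (by fun_prop) fun u hu => ⟨trivial, hu⟩
  have hPint : IntegrableOn P'.uncurry (Ioc 0 T ×ˢ Ioc 0 (Real.pi / 2)) := by
    refine (ContinuousOn.integrableOn_compact (isCompact_Icc.prod isCompact_Icc)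
      (hP'c.mono (prod_mono_left (subset_univ (Icc 0 T))))).mono_set
      (prod_mono Ioc_subset_Icc_self Ioc_subset_Icc_self)
  have hswap : ∫ s in (0 : ℝ)..T, ∫ u in (0 : ℝ)..(Real.pi / 2), P' s u = 0 := by
    rw [intervalIntegral_intervalIntegral_swap (by rwa [uIoc_of_le hT, uIoc_of_le hpi])]
    rw [intervalIntegral.integral_congr (g := fun _ => 0)]
    · simp
    · rw [uIcc_of_le hpi]; exact hPu
  have hstep : ∀ s, ∫ u in (0 : ℝ)..(Real.pi / 2),
      exactDensity a b (joinPt (c s) q u) (Real.cos u • c' s) (joinVel (c s) q u) =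
      (1 / 2) * ((∫ u in (0 : ℝ)..(Real.pi / 2), P' s u) +
        wedge a b (c s) (c' s) / dot (c s) (c s)) := by
    intro s
    rw [intervalIntegral.integral_congr (g := fun u => (1 / 2) * (P' s u - Q' s u)),
      intervalIntegral.integral_const_mul, intervalIntegral.integral_sub (hPs s) (hQs' s), hQs s,
      sub_neg_eq_add]
    rw [uIcc_of_le hpi]; exact hkey s
  simp_rw [hstep]
  have hcs : ∀ s, c s ≠ 0 := fun s => by
    simpa [joinPt] using h0 s 0 ⟨le_rfl, hpi⟩
  rw [intervalIntegral.integral_const_mul, intervalIntegral.integral_add, hswap, zero_add]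
  · have := hPint
    rw [IntegrableOn, Measure.volume_eq_prod, ← Measure.prod_restrict] at this
    · rw [intervalIntegrable_iff_integrableOn_Ioc_of_le hT]
      have h2 := this.integral_prod_left
      simpa only [intervalIntegral.integral_of_le hpi, IntegrableOn, Function.uncurry_apply_pair] using h2
  · refine Continuous.intervalIntegrable ?_ _ _
    exact (Continuous.wedge a b hcc hc').div (Continuous.dot hcc hcc)
      fun s => (dot_self_pos (hcs s)).ne'

/-- The form is alternating. In the Gauss integrand `v` is the `s`-velocity, so the `t`-velocity may
be corrected by multiples of it. -/
theorem directionForm_add_smul (x v w z : R4) (k : ℝ) :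
    directionForm x v w (z - k • v) = directionForm x v w z := by
  unfold directionForm
  congr 1
  simp [Matrix.det_succ_row_zero, Fin.sum_univ_succ, Fin.succAbove]
  ring

theorem directionForm_rotGen_eq (a b : ℝ) (x v w : R4) :
    directionForm x v w (rotGen a b x) = (1 / (2 * Real.pi ^ 2)) * exactDensity a b x v w := by
  rw [directionForm_rotGen, exactDensity]
  ring

/-- Swapping the two outer integrals of a parametrised integral. -/
theorem integral_swap_outer {f : ℝ → ℝ → ℝ → ℝ} {S T U : ℝ} (hU : 0 ≤ U)
    (hf : ContinuousOn (fun z : ℝ × ℝ × ℝ => f z.1 z.2.1 z.2.2) (univ ×ˢ univ ×ˢ Icc 0 U)) :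
    ∫ s in (0 : ℝ)..S, ∫ t in (0 : ℝ)..T, ∫ u in (0 : ℝ)..U, f s t u =
      ∫ t in (0 : ℝ)..T, ∫ s in (0 : ℝ)..S, ∫ u in (0 : ℝ)..U, f s t u := by
  -- Clamping `u` to `[0, U]` turns continuity on the slab into global continuity without changing
  -- the integrals.
  have hg : Continuous fun z : ℝ × ℝ × ℝ => f z.1 z.2.1 (projIcc 0 U hU z.2.2) :=
    hf.comp_continuous (f := fun z : ℝ × ℝ × ℝ => (z.1, z.2.1, (projIcc 0 U hU z.2.2 : ℝ)))
      (by fun_prop) fun z => ⟨trivial, trivial, (projIcc 0 U hU z.2.2).2⟩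
  have heq : ∀ s t, ∫ u in (0 : ℝ)..U, f s t u = ∫ u in (0 : ℝ)..U, f s t (projIcc 0 U hU u) := by
    intro s t
    refine intervalIntegral.integral_congr fun u hu => ?_
    rw [uIcc_of_le hU] at hu
    simp [projIcc_of_mem hU hu]
  simp_rw [heq]
  refine intervalIntegral_intervalIntegral_swap ?_
  have hc : Continuous (fun z : ℝ × ℝ => ∫ u in (0 : ℝ)..U, f z.1 z.2 (projIcc 0 U hU u)) := by
    refine intervalIntegral.continuous_parametric_intervalIntegral_of_continuous' ?_ 0 U
    exact hg.comp (by fun_prop : Continuous fun z : (ℝ × ℝ) × ℝ => (z.1.1, z.1.2, z.2))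
  exact (hc.continuousOn.integrableOn_compact (isCompact_uIcc.prod isCompact_uIcc)).mono_set
    (prod_mono uIoc_subset_uIcc uIoc_subset_uIcc)

/-- The linking number of a closed curve `c₁` with an orbit `c₂` of a rotation, when up to a
reparametrisation with constant speed `c₁` is an orbit of that rotation, too. -/
theorem linkingNumber_eq {c₁ c₁' : ℝ → R4} (a b κ K : ℝ) (q : R4) {T₁ T₂ : ℝ} (hT₁ : 0 ≤ T₁)
    (hc : ∀ s, HasDerivAt c₁ (c₁' s) s) (hc' : Continuous c₁') (hper : Function.Periodic c₁ T₁)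
    (hκ : ∀ s, κ • c₁' s = rotGen a b (c₁ s))
    (hK : ∀ s, wedge a b (c₁ s) (c₁' s) = K * dot (c₁ s) (c₁ s))
    (h0 : ∀ s t, ∀ u ∈ Icc 0 (Real.pi / 2), joinPt (c₁ s) (torusCurve a b q t) u ≠ 0) :
    linkingNumber c₁ (torusCurve a b q) T₁ T₂ = T₁ * T₂ * K / (4 * Real.pi ^ 2) := by
  have hpi : (0 : ℝ) ≤ Real.pi / 2 := by positivity
  have hcc : Continuous c₁ := continuous_iff_continuousAt.2 fun s => (hc s).continuousAt
  have hqc := continuous_torusCurve a b q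
  have hint : ∀ s t u, directionForm (joinMap c₁ (torusCurve a b q) s u t)
      (deriv (fun s' => joinMap c₁ (torusCurve a b q) s' u t) s)
      (deriv (fun u' => joinMap c₁ (torusCurve a b q) s u' t) u)
      (deriv (fun t' => joinMap c₁ (torusCurve a b q) s u t') t) =
      (1 / (2 * Real.pi ^ 2)) * exactDensity a b (joinPt (c₁ s) (torusCurve a b q t) u)
        (Real.cos u • c₁' s) (joinVel (c₁ s) (torusCurve a b q t) u) := by
    intro s t u
    have h1 : HasDerivAt (fun s' => joinMap c₁ (torusCurve a b q) s' u t) (Real.cos u • c₁' s) s :=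
      ((hc s).const_smul (Real.cos u)).sub_const (Real.sin u • torusCurve a b q t)
    have h2 : HasDerivAt (fun u' => joinMap c₁ (torusCurve a b q) s u' t)
        (joinVel (c₁ s) (torusCurve a b q t) u) u := hasDerivAt_joinPt _ _ _
    have h3 : HasDerivAt (fun t' => joinMap c₁ (torusCurve a b q) s u t')
        (-(Real.sin u • rotGen a b (torusCurve a b q t))) t :=
      ((hasDerivAt_torusCurve a b q t).const_smul (Real.sin u)).const_sub (Real.cos u • c₁ s)
    -- By linearity, rotating `c₂` alone is rotating the whole join point and undoing the motion of
    -- `c₁`. By `hκ` the latter is parallel to the `s`-velocity and drops out.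
    have h4 : -(Real.sin u • rotGen a b (torusCurve a b q t)) =
        rotGen a b (joinPt (c₁ s) (torusCurve a b q t) u) - κ • (Real.cos u • c₁' s) := by
      rw [smul_comm, hκ]
      generalize torusCurve a b q t = y
      ext i
      fin_cases i <;> simp [rotGen, joinPt] <;> ring
    rw [h1.deriv, h2.deriv, h3.deriv, h4, directionForm_add_smul]
    exact directionForm_rotGen_eq a b _ _ _
  unfold linkingNumber
  simp_rw [hint, intervalIntegral.integral_const_mul]
  -- With `t` outermost, the inner double integral runs over the annulus between `c₁` and a fixed
  -- point, where Stokes' theorem applies.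
  rw [integral_swap_outer hpi]
  · have hst : ∀ t, ∫ s in (0 : ℝ)..T₁, ∫ u in (0 : ℝ)..(Real.pi / 2),
        exactDensity a b (joinPt (c₁ s) (torusCurve a b q t) u) (Real.cos u • c₁' s)
          (joinVel (c₁ s) (torusCurve a b q t) u) = (1 / 2) * (T₁ * K) := by
      intro t
      rw [integral_exactDensity a b hT₁ hc hc' hper fun s u hu => h0 s t u hu]
      have : ∀ s, wedge a b (c₁ s) (c₁' s) / dot (c₁ s) (c₁ s) = K := by
        intro s
        have hne : c₁ s ≠ 0 := by simpa [joinPt] using h0 s 0 0 ⟨le_rfl, hpi⟩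
        rw [hK, mul_div_assoc, div_self (dot_self_pos hne).ne', mul_one]
      simp_rw [this]
      simp
    simp_rw [hst]
    simp only [intervalIntegral.integral_const, smul_eq_mul, sub_zero]
    field_simp
    ring
  · refine continuousOn_exactDensity a b ?_ ?_ ?_ fun z hz => h0 _ _ _ hz.2.2
    · unfold joinPt; fun_prop
    · fun_prop
    · unfold joinVel; fun_prop

/-! ### The mean slope of a positive function, and resonances on both sides of it. -/

/-- If `g' / g²` has the same integral as `c / g²` and `s (g' - c)` has a sign, then `g' = c`. -/
theorem deriv_eq_of_sign {g g' : ℝ → ℝ} {c s : ℝ} (hs : s ≠ 0) (hg : ∀ m, HasDerivAt g (g' m) m)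
    (hpos : ∀ m, 0 < g m) (hlim : Tendsto g atTop atTop)
    (hint : IntegrableOn (fun m => 1 / g m ^ 2) (Ioi 0))
    (hc : c * ∫ m in Ioi (0 : ℝ), 1 / g m ^ 2 = 1 / g 0)
    (hsign : ∀ m, 0 < m → s * (g' m - c) ≤ 0) {m : ℝ} (hm : 0 < m) : g' m = c := by
  have hgc : Continuous g := continuous_iff_continuousAt.2 fun m => (hg m).continuousAt
  have hw : Continuous fun m => 1 / g m ^ 2 :=
    continuous_const.div (hgc.pow 2) fun m => (pow_pos (hpos m) 2).ne'
  -- `Ψ m` is the integral of `s (g' - c) / g²` from `0` to `m`. It is monotone by the sign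
  -- hypothesis, vanishes at `0`, and tends to `0` by the choice of `c`; hence it is zero.
  set Ψ : ℝ → ℝ := fun m => s * (-(g m)⁻¹ + 1 / g 0 - c * ∫ x in (0 : ℝ)..m, 1 / g x ^ 2) with hΨ
  have hd : ∀ m, HasDerivAt Ψ (s * (g' m - c) * (1 / g m ^ 2)) m := by
    intro m
    have h1 := (hg m).inv (hpos m).ne'
    have h2 : HasDerivAt (fun m => ∫ x in (0 : ℝ)..m, 1 / g x ^ 2) (1 / g m ^ 2) m :=
      intervalIntegral.integral_hasDerivAt_right (hw.intervalIntegrable _ _)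
        (hw.stronglyMeasurableAtFilter _ _) hw.continuousAt
    exact (((h1.neg.add_const (1 / g 0)).sub (h2.const_mul c)).const_mul s).congr_deriv (by ring)
  have hanti : AntitoneOn Ψ (Ici 0) := by
    refine antitoneOn_of_deriv_nonpos (convex_Ici 0)
      (fun m _ => (hd m).continuousAt.continuousWithinAt)
      (fun m _ => (hd m).differentiableAt.differentiableWithinAt) fun m hm => ?_
    rw [interior_Ici] at hm
    rw [(hd m).deriv]
    exact mul_nonpos_of_nonpos_of_nonneg (hsign m hm) (by positivity)
  have h0 : Ψ 0 = 0 := by simp [hΨ]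
  have htend : Tendsto Ψ atTop (𝓝 0) := by
    have h1 : Tendsto (fun m => (g m)⁻¹) atTop (𝓝 0) := hlim.inv_tendsto_atTop
    have h2 := intervalIntegral_tendsto_integral_Ioi 0 hint tendsto_id
    have h3 := ((h1.neg.add_const (1 / g 0)).sub (h2.const_mul c)).const_mul s
    rw [hc] at h3
    simpa [hΨ] using h3
  have hzero : ∀ m ∈ Ici (0 : ℝ), Ψ m = 0 := by
    intro m hm
    refine le_antisymm (h0 ▸ hanti self_mem_Ici hm hm) ?_
    refine le_of_tendsto htend ?_
    filter_upwards [eventually_ge_atTop m] with x hx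
    exact hanti hm (hm.out.trans hx) hx
  have hz : HasDerivAt Ψ 0 m :=
    (hasDerivAt_const m (0 : ℝ)).congr_of_eventuallyEq <| by
      filter_upwards [Ioi_mem_nhds hm] with x hx using hzero x hx.out.le
  have := (hd m).unique hz
  have hp := hpos m
  have h4 : (1 : ℝ) / g m ^ 2 ≠ 0 := by positivity
  rcases mul_eq_zero.1 this with h | h
  · rcases mul_eq_zero.1 h with h | h
    · exact absurd h hs
    · linarith
  · exact absurd h h4

/-- A differentiable function which takes positive and nonpositive values has a noncritical point
at which it is positive. -/
theorem exists_pos_deriv_ne_zero {h : ℝ → ℝ} (hd : Differentiable ℝ h) {m₀ m₁ : ℝ} (hm₀ : 0 < m₀)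
    (hm₁ : 0 < m₁) (h₀ : 0 < h m₀) (h₁ : h m₁ ≤ 0) : ∃ m, 0 < m ∧ 0 < h m ∧ deriv h m ≠ 0 := by
  by_contra! hcon
  -- Composing `h` with a function that is flat on the nonpositive reals and positive beyond gives
  -- zero derivative everywhere, with no separate analysis at the boundary of `{h > 0}`.
  have he : Differentiable ℝ expNegInvGlue := (expNegInvGlue.contDiff (n := 1)).differentiable one_ne_zero
  have hψ : ∀ m ∈ Ioi (0 : ℝ), HasDerivAt (fun x => expNegInvGlue (h x)) 0 m := by
    intro m hm
    have hm' := (he (h m)).hasDerivAt.comp m (hd m).hasDerivAt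
    refine hm'.congr_deriv ?_
    rcases lt_or_ge 0 (h m) with hp | hp
    · rw [hcon m hm hp, mul_zero]
    · have : IsLocalMin expNegInvGlue (h m) := Eventually.of_forall fun x => by
        rw [expNegInvGlue.zero_of_nonpos hp]; exact expNegInvGlue.nonneg x
      rw [this.deriv_eq_zero, zero_mul]
  have heq : expNegInvGlue (h m₀) = expNegInvGlue (h m₁) :=
    (convex_Ioi (0 : ℝ)).is_const_of_fderivWithin_eq_zero (𝕜 := ℝ)
      (f := fun x => expNegInvGlue (h x))
      (fun m hm => (hψ m hm).differentiableAt.differentiableWithinAt)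
      (fun m hm => by
        rw [fderivWithin_of_isOpen isOpen_Ioi hm, (hψ m hm).hasFDerivAt.fderiv]; ext; simp)
      hm₀ hm₁
  rw [expNegInvGlue.zero_of_nonpos h₁] at heq
  exact (expNegInvGlue.pos_of_pos h₀).ne' heq

/-- The angular velocities `2 x` and `2 y` have a common period. -/
def Resonant (x y : ℝ) : Prop :=
  ∃ T : ℝ, 0 < T ∧ ∃ k l : ℤ, 2 * x * T = k * (2 * Real.pi) ∧ 2 * y * T = l * (2 * Real.pi)

/-- The common period is the denominator of `q` times `π / |y|`; for negative `y` both winding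
numbers change sign. -/
theorem resonant_of_mul_eq {x y : ℝ} (q : ℚ) (hy : y ≠ 0) (h : x = q * y) : Resonant x y := by
  have hpi := Real.pi_pos
  have hq : (q : ℝ) = q.num / q.den := by exact_mod_cast (Rat.num_div_den q).symm
  have hden : (0 : ℝ) < q.den := by exact_mod_cast q.den_pos
  rcases hy.lt_or_gt with hy' | hy'
  · refine ⟨-(q.den * Real.pi / y), by
      rw [neg_pos]; exact div_neg_of_pos_of_neg (by positivity) hy', -q.num, -q.den, ?_, ?_⟩
    · rw [h, hq]; push_cast; field_simp
    · push_cast; field_simp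
  · refine ⟨q.den * Real.pi / y, by positivity, q.num, q.den, ?_, ?_⟩
    · rw [h, hq]; field_simp
    · push_cast; field_simp

theorem resonant_zero {x : ℝ} (hx : x ≠ 0) : Resonant x 0 := by
  have hpi := Real.pi_pos
  rcases hx.lt_or_gt with h | h
  · exact ⟨-(Real.pi / x), by rw [neg_pos]; exact div_neg_of_pos_of_neg hpi h, -1, 0,
      by push_cast; field_simp, by simp⟩
  · exact ⟨Real.pi / x, by positivity, 1, 0, by push_cast; field_simp, by simp⟩

/-- Resonances accumulate at the points where `g'' ≠ 0`. -/
theorem exists_resonant {g g' : ℝ → ℝ} (hg : ∀ m, HasDerivAt g (g' m) m)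
    (hpos : ∀ m, 0 < g m) (hd : Differentiable ℝ g') {m : ℝ} (hm : deriv g' m ≠ 0) {s : Set ℝ}
    (hs : s ∈ 𝓝 m) : ∃ x ∈ s, Resonant (g x - x * g' x) (g' x) := by
  by_contra! hcon
  -- A zero of `g'` is itself a resonance, so without resonances the frequency ratio below is
  -- defined.
  have hne : ∀ x ∈ s, g' x ≠ 0 := fun x hx h0 => hcon x hx <| by
    rw [h0]; exact resonant_zero (by simpa using (hpos x).ne')
  obtain ⟨ε, hε, hball⟩ := Metric.mem_nhds_iff.1 hs
  set h : ℝ → ℝ := fun x => (g x - x * g' x) / g' x with hh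
  have hnum : ∀ x, HasDerivAt (fun x => g x - x * g' x) (g' x - (1 * g' x + x * deriv g' x)) x :=
    fun x => (hg x).sub ((hasDerivAt_id x).mul (hd x).hasDerivAt)
  have hcont : ContinuousOn h (Metric.ball m ε) := fun x hx =>
    ((hnum x).continuousAt.div (hd x).continuousAt (hne x (hball hx))).continuousWithinAt
  have hrat : ∀ x ∈ Metric.ball m ε, ∀ q : ℚ, h x ≠ q := fun x hx q hq => hcon x (hball hx) <|
    resonant_of_mul_eq q (hne x (hball hx)) (by rw [← hq, hh, div_mul_cancel₀ _ (hne x (hball hx))])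
  -- A continuous function on a connected set that omits all rationals is constant.
  have hconst : ∀ x ∈ Metric.ball m ε, h x = h m := by
    intro x hx
    have hpre : OrdConnected (h '' Metric.ball m ε) :=
      ((convex_ball m ε).isPreconnected.image h hcont).ordConnected
    have hmm := Metric.mem_ball_self (x := m) hε
    by_contra hxm
    rcases lt_or_gt_of_ne hxm with hlt | hlt
    · obtain ⟨q, hq1, hq2⟩ := exists_rat_btwn hlt
      obtain ⟨y, hy, hyq⟩ := hpre.out ⟨x, hx, rfl⟩ ⟨m, hmm, rfl⟩ ⟨hq1.le, hq2.le⟩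
      exact hrat y hy q hyq
    · obtain ⟨q, hq1, hq2⟩ := exists_rat_btwn hlt
      obtain ⟨y, hy, hyq⟩ := hpre.out ⟨m, hmm, rfl⟩ ⟨x, hx, rfl⟩ ⟨hq1.le, hq2.le⟩
      exact hrat y hy q hyq
  have hgm := hne m (mem_of_mem_nhds hs)
  have hder := (hnum m).div (hd m).hasDerivAt hgm
  have h0 : HasDerivAt h 0 m := (hasDerivAt_const m (h m)).congr_of_eventuallyEq <| by
    filter_upwards [Metric.ball_mem_nhds m hε] with x hx using hconst x hx
  have := hder.unique h0
  rw [div_eq_zero_iff] at this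
  rcases this with h1 | h1
  -- The ratio has derivative `-g g'' / g'²`, whose vanishing contradicts `g > 0` and `g'' ≠ 0`.
  · have : g m * deriv g' m = 0 := by linear_combination -h1
    exact (mul_ne_zero (hpos m).ne' hm) this
  · exact hgm (by simpa using h1)

/-- Either `g` is affine, or resonances occur with `g'` on either side of its mean `c`. -/
theorem affine_or_exists_resonant {g g' : ℝ → ℝ} {c : ℝ} (hg : ∀ m, HasDerivAt g (g' m) m)
    (hpos : ∀ m, 0 < g m) (hd : Differentiable ℝ g') (hlim : Tendsto g atTop atTop)
    (hint : IntegrableOn (fun m => 1 / g m ^ 2) (Ioi 0))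
    (hc : c * ∫ m in Ioi (0 : ℝ), 1 / g m ^ 2 = 1 / g 0) :
    (∀ m, 0 < m → g' m = c) ∨
      ((∃ m, 0 < m ∧ c < g' m ∧ Resonant (g m - m * g' m) (g' m)) ∧
        ∃ m, 0 < m ∧ g' m < c ∧ Resonant (g m - m * g' m) (g' m)) := by
  by_cases h : ∀ m, 0 < m → g' m = c
  · exact Or.inl h
  right
  have key : ∀ s : ℝ, s ≠ 0 → ∃ m, 0 < m ∧ 0 < s * (g' m - c) := by
    intro s hs
    by_contra! hcon
    exact h fun m hm => deriv_eq_of_sign hs hg hpos hlim hint hc hcon hm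
  obtain ⟨m₀, hm₀, h₀⟩ := key 1 one_ne_zero
  obtain ⟨m₁, hm₁, h₁⟩ := key (-1) (by norm_num)
  have main : ∀ s : ℝ, (∃ m, 0 < m ∧ 0 < s * (g' m - c)) → (∃ m, 0 < m ∧ s * (g' m - c) ≤ 0) →
      ∃ m, 0 < m ∧ 0 < s * (g' m - c) ∧ Resonant (g m - m * g' m) (g' m) := by
    rintro s ⟨a, ha, ha'⟩ ⟨b, hb, hb'⟩
    have hds : Differentiable ℝ fun m => s * (g' m - c) := (hd.sub_const c).const_mul s
    obtain ⟨m, hm, hm1, hm2⟩ := exists_pos_deriv_ne_zero hds ha hb ha' hb'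
    have hm3 : deriv g' m ≠ 0 := fun h0 => hm2 <| by
      have := (((hd m).hasDerivAt.sub_const c).const_mul s).deriv
      rw [this, h0, mul_zero]
    obtain ⟨x, hx, hx'⟩ := exists_resonant hg hpos hd hm3
      (inter_mem (Ioi_mem_nhds hm) (hds.continuous.continuousAt.eventually (lt_mem_nhds hm1)))
    exact ⟨x, hx.1, hx.2, hx'⟩
  obtain ⟨a, ha, ha1, ha2⟩ := main 1 ⟨m₀, hm₀, h₀⟩ ⟨m₁, hm₁, by linarith⟩
  obtain ⟨b, hb, hb1, hb2⟩ := main (-1) ⟨m₁, hm₁, h₁⟩ ⟨m₀, hm₀, by linarith⟩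
  exact ⟨⟨a, ha, by linarith, ha2⟩, b, hb, by linarith, hb2⟩

/-! ### The contact volume as an integral over the half-line. -/

theorem lintegral_Ioi_eq_sq (φ : ℝ → ℝ≥0∞) :
    ∫⁻ R in Ioi (0 : ℝ), φ R = ∫⁻ r in Ioi (0 : ℝ), ENNReal.ofReal (2 * r) * φ (r ^ 2) := by
  have himg : (fun r : ℝ => r ^ 2) '' Ioi 0 = Ioi 0 := by
    ext y
    refine ⟨?_, fun hy => ⟨√y, Real.sqrt_pos.2 hy, Real.sq_sqrt hy.out.le⟩⟩
    rintro ⟨x, hx, rfl⟩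
    exact pow_pos hx.out 2
  have h := lintegral_image_eq_lintegral_abs_deriv_mul (s := Ioi (0 : ℝ)) (f := fun r => r ^ 2)
    (f' := fun r => 2 * r) measurableSet_Ioi
    (fun x _ => by simpa using (hasDerivAt_pow 2 x).hasDerivWithinAt)
    (fun x hx y hy hxy => (pow_left_inj₀ hx.out.le hy.out.le two_ne_zero).1 hxy) φ
  rw [himg] at h
  rw [h]
  refine setLIntegral_congr_fun measurableSet_Ioi fun r hr => ?_
  have : 0 < r := hr
  simp only [abs_of_pos (show 0 < 2 * r by positivity)]

theorem lintegral_Ioi_eq_mul (φ : ℝ → ℝ≥0∞) {a : ℝ} (ha : 0 < a) :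
    ∫⁻ R in Ioi (0 : ℝ), φ R = ∫⁻ m in Ioi (0 : ℝ), ENNReal.ofReal a * φ (a * m) := by
  have himg : (fun r : ℝ => a * r) '' Ioi 0 = Ioi 0 := by
    rw [Set.image_mul_left_Ioi ha, mul_zero]
  have h := lintegral_image_eq_lintegral_abs_deriv_mul (s := Ioi (0 : ℝ)) (f := fun r => a * r)
    (f' := fun _ => a) measurableSet_Ioi
    (fun x _ => by simpa using ((hasDerivAt_id x).const_mul a).hasDerivWithinAt)
    (fun x _ y _ hxy => mul_left_cancel₀ ha.ne' hxy) φ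
  rw [himg] at h
  rw [h, abs_of_pos ha]

/-- Integration of a radial function over the plane. -/
theorem lintegral_plane_radial {φ : ℝ → ℝ≥0∞} (hφ : Measurable φ) :
    ∫⁻ p : ℝ × ℝ, φ (p.1 ^ 2 + p.2 ^ 2) = ENNReal.ofReal Real.pi * ∫⁻ R in Ioi (0 : ℝ), φ R := by
  have hpi := Real.pi_pos
  rw [← lintegral_comp_polarCoord_symm, polarCoord_target, Measure.volume_eq_prod,
    ← Measure.prod_restrict, lintegral_prod, lintegral_Ioi_eq_sq φ,
    ← lintegral_const_mul _ (by fun_prop)]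
  · refine setLIntegral_congr_fun measurableSet_Ioi fun r hr => ?_
    have hr' : 0 < r := hr
    have : ∀ θ : ℝ, (r * Real.cos θ) ^ 2 + (r * Real.sin θ) ^ 2 = r ^ 2 := fun θ => by
      linear_combination r ^ 2 * Real.cos_sq_add_sin_sq θ
    simp only [polarCoord_symm_apply, this, smul_eq_mul, lintegral_const,
      Measure.restrict_apply MeasurableSet.univ, univ_inter, Real.volume_Ioo]
    rw [mul_right_comm, ← ENNReal.ofReal_mul hr'.le, ← mul_assoc, ← ENNReal.ofReal_mul hpi.le]
    congr 2; ring
  · have : Measurable fun z : ℝ × ℝ => polarCoord.symm z :=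
      continuous_polarCoord_symm.measurable
    fun_prop

/-- Coordinates on `ℝ⁴`, as a map to an iterated product. -/
def coords (x : R4) : ℝ × ℝ × ℝ × ℝ := (x 0, x 1, x 2, x 3)

theorem measurePreserving_coords : MeasurePreserving coords := by
  have h1 := PiLp.volume_preserving_ofLp (Fin 4)
  have h2 := volume_preserving_piFinSuccAbove (fun _ : Fin 4 => ℝ) 0
  have h3 := volume_preserving_piFinSuccAbove (fun _ : Fin 3 => ℝ) 0
  have h4 := volume_preserving_finTwoArrow ℝ
  have hid : MeasurePreserving (id : ℝ → ℝ) := MeasurePreserving.id _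
  exact (hid.prod (hid.prod h4)).comp ((hid.prod h3).comp (h2.comp h1))

/-- Integration of a toric function over `ℝ⁴`. -/
theorem lintegral_toric {φ : ℝ × ℝ → ℝ≥0∞} (hφ : Measurable φ) :
    ∫⁻ x : R4, φ (x 0 ^ 2 + x 1 ^ 2, x 2 ^ 2 + x 3 ^ 2) =
      ENNReal.ofReal (Real.pi ^ 2) * ∫⁻ R in Ioi (0 : ℝ), ∫⁻ S in Ioi (0 : ℝ), φ (R, S) := by
  have hpi := Real.pi_pos
  have hm : Measurable fun z : ℝ × ℝ × ℝ × ℝ =>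
      φ (z.1 ^ 2 + z.2.1 ^ 2, z.2.2.1 ^ 2 + z.2.2.2 ^ 2) := by fun_prop
  have h1 := measurePreserving_coords.lintegral_comp hm
  simp only [coords] at h1
  have hmS : Measurable fun R => ∫⁻ S in Ioi (0 : ℝ), φ (R, S) := hφ.lintegral_prod_right'
  rw [h1, Measure.volume_eq_prod, lintegral_prod _ hm.aemeasurable]
  have h2 : ∀ a : ℝ, ∫⁻ z : ℝ × ℝ × ℝ, φ (a ^ 2 + z.1 ^ 2, z.2.1 ^ 2 + z.2.2 ^ 2) =
      ∫⁻ b : ℝ, ENNReal.ofReal Real.pi * ∫⁻ S in Ioi (0 : ℝ), φ (a ^ 2 + b ^ 2, S) := by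
    intro a
    rw [Measure.volume_eq_prod, lintegral_prod _ (by fun_prop)]
    refine lintegral_congr fun b => ?_
    exact lintegral_plane_radial (φ := fun S => φ (a ^ 2 + b ^ 2, S)) (by fun_prop)
  simp_rw [h2]
  have h3 := lintegral_prod (μ := (volume : Measure ℝ)) (ν := (volume : Measure ℝ))
    (fun p : ℝ × ℝ => ENNReal.ofReal Real.pi * ∫⁻ S in Ioi (0 : ℝ), φ (p.1 ^ 2 + p.2 ^ 2, S))
    (by fun_prop)
  rw [← h3, ← Measure.volume_eq_prod,
    lintegral_plane_radial (φ := fun R => ENNReal.ofReal Real.pi * ∫⁻ S in Ioi (0 : ℝ), φ (R, S))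
      (by fun_prop), lintegral_const_mul _ hmS, ← mul_assoc, ← ENNReal.ofReal_mul hpi.le, sq]

theorem lintegral_mul_exp {h : ℝ} (hh : 0 < h) :
    ∫⁻ t in Ioi (0 : ℝ), ENNReal.ofReal (t * Real.exp (-(h * t))) =
      ENNReal.ofReal (1 / h ^ 2) := by
  have key := Real.integral_rpow_mul_exp_neg_mul_Ioi (a := 2) (r := h) two_pos hh
  have e : ∀ t : ℝ, t ^ ((2 : ℝ) - 1) = t := fun t => by norm_num
  simp only [e, Real.Gamma_two, mul_one] at key
  rw [← ofReal_integral_eq_lintegral_ofReal, key]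
  · congr 1
    rw [show (2 : ℝ) = (2 : ℕ) by norm_num, Real.rpow_natCast, one_div_pow]
  · exact .of_integral_ne_zero (by rw [key]; positivity)
  · filter_upwards [ae_restrict_mem measurableSet_Ioi] with t ht
    exact mul_nonneg ht.out.le (Real.exp_pos _).le

/-- The quadrant integral of `e^{-F}` in the coordinates `R`, `m = S / R`. -/
theorem lintegral_quadrant {F : ℝ × ℝ → ℝ} (hF : Measurable F)
    (hpos : ∀ v : ℝ × ℝ, v ≠ 0 → 0 < F v)
    (hhom : ∀ (t : ℝ) (v : ℝ × ℝ), 0 < t → F (t • v) = t * F v) :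
    ∫⁻ R in Ioi (0 : ℝ), ∫⁻ S in Ioi (0 : ℝ), ENNReal.ofReal (Real.exp (-F (R, S))) =
      ∫⁻ m in Ioi (0 : ℝ), ENNReal.ofReal (1 / F (1, m) ^ 2) := by
  have h1 : ∀ R ∈ Ioi (0 : ℝ), ∫⁻ S in Ioi (0 : ℝ), ENNReal.ofReal (Real.exp (-F (R, S))) =
      ∫⁻ m in Ioi (0 : ℝ), ENNReal.ofReal (R * Real.exp (-(F (1, m) * R))) := by
    intro R hR
    rw [lintegral_Ioi_eq_mul _ hR.out]
    refine lintegral_congr fun m => ?_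
    have : F (R, R * m) = F (1, m) * R := by
      rw [mul_comm (F _), ← hhom R (1, m) hR.out]; simp
    rw [this, ← ENNReal.ofReal_mul hR.out.le]
  rw [setLIntegral_congr_fun measurableSet_Ioi h1, lintegral_lintegral_swap (by fun_prop)]
  exact lintegral_congr fun m => lintegral_mul_exp (hpos _ (by simp))

/-- Polar coordinates on `ℝ⁴`. -/
theorem lintegral_eq_sphere {Φ : R4 → ℝ≥0∞} (hΦ : Measurable Φ) :
    ∫⁻ x : R4, Φ x = ∫⁻ x : Metric.sphere (0 : R4) 1, (∫⁻ r in Ioi (0 : ℝ),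
      ENNReal.ofReal (r ^ 3) * Φ (r • (x : R4))) ∂(volume : Measure R4).toSphere := by
  have hmp := (volume : Measure R4).measurePreserving_homeomorphUnitSphereProd
  have h1 := hmp.lintegral_comp_emb (Homeomorph.measurableEmbedding _)
    (fun p : Metric.sphere (0 : R4) 1 × Ioi (0 : ℝ) => Φ ((p.2 : ℝ) • (p.1 : R4)))
  have h2 : ∀ x : ({0}ᶜ : Set R4), (((homeomorphUnitSphereProd R4 x).2 : ℝ) •
      ((homeomorphUnitSphereProd R4 x).1 : R4)) = x := by
    intro x
    have : ‖(x : R4)‖ ≠ 0 := norm_ne_zero_iff.2 x.2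
    simp [smul_smul, this]
  simp only [h2] at h1
  rw [lintegral_subtype_comap (measurableSet_singleton (0 : R4)).compl,
    restrict_compl_singleton] at h1
  have hm : Measurable fun p : Metric.sphere (0 : R4) 1 × Ioi (0 : ℝ) =>
      Φ ((p.2 : ℝ) • (p.1 : R4)) := by fun_prop
  rw [h1, lintegral_prod _ hm.aemeasurable]
  refine lintegral_congr fun x => ?_
  have hd : Module.finrank ℝ R4 - 1 = 3 := by simp
  have hmx : Measurable fun r : Ioi (0 : ℝ) => Φ ((r : ℝ) • (x : R4)) := by fun_prop
  rw [hd, Measure.volumeIoiPow, lintegral_withDensity_eq_lintegral_mul _ (by fun_prop) hmx]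
  exact lintegral_subtype_comap measurableSet_Ioi
    fun r : ℝ => ENNReal.ofReal (r ^ 3) * Φ (r • (x : R4))

/-- On each ray the substitution `t = r²` turns `r³ exp (-r² H)` into `½ t exp (-t H)`, whose
integral is `½ / H²`. This is also the density of the contact volume. -/
theorem lintegral_exp_neg_eq_sphere {H : R4 → ℝ} (hH : Measurable H)
    (hpos : ∀ x, x ≠ 0 → 0 < H x) (hhom : ∀ (t : ℝ) (x : R4), 0 < t → H (t • x) = t ^ 2 * H x) :
    ∫⁻ x : R4, ENNReal.ofReal (Real.exp (-H x)) =
      ∫⁻ x : Metric.sphere (0 : R4) 1, ENNReal.ofReal (1 / 2 * (1 / H x ^ 2))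
        ∂(volume : Measure R4).toSphere := by
  rw [lintegral_eq_sphere (by fun_prop)]
  refine lintegral_congr fun x => ?_
  have hx : (x : R4) ≠ 0 := Metric.ne_of_mem_sphere x.2 one_ne_zero
  rw [ENNReal.ofReal_mul (by norm_num), ← lintegral_mul_exp (hpos x hx),
    lintegral_Ioi_eq_sq (fun t => ENNReal.ofReal (t * Real.exp (-(H x * t)))),
    ← lintegral_const_mul _ (by fun_prop)]
  refine setLIntegral_congr_fun measurableSet_Ioi fun r hr => ?_
  have hr' : 0 < r := hr
  rw [hhom r x hr', ← ENNReal.ofReal_mul (by positivity), ← ENNReal.ofReal_mul (by positivity),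
    ← ENNReal.ofReal_mul (by norm_num)]
  congr 1
  rw [mul_comm (H x)]; ring

/-- The density of the contact volume on the unit sphere. -/
theorem liouvilleWedge_radial {H : R4 → ℝ} {x : R4} (hx : ‖x‖ = 1) (hd : DifferentiableAt ℝ H x)
    (hpos : 0 < H x) :
    liouvilleWedge (radial H x) (fderiv ℝ (radial H) x (frame₁ x))
      (fderiv ℝ (radial H) x (frame₂ x)) (fderiv ℝ (radial H) x (frame₃ x)) =
      1 / 2 * (1 / H x ^ 2) := by
  have hs : DifferentiableAt ℝ (fun y => (Real.sqrt (H y))⁻¹) x :=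
    (hd.sqrt hpos.ne').inv (Real.sqrt_pos.2 hpos).ne'
  have hfd : ∀ v, fderiv ℝ (radial H) x v =
      (Real.sqrt (H x))⁻¹ • v + (fderiv ℝ (fun y => (Real.sqrt (H y))⁻¹) x v) • x := by
    intro v
    have := (hs.hasFDerivAt.smul (hasFDerivAt_id x)).fderiv
    have h2 : radial H = fun y => (Real.sqrt (H y))⁻¹ • id y := rfl
    rw [h2]
    erw [this]
    simp
  rw [hfd, hfd, hfd]
  generalize fderiv ℝ (fun y => (Real.sqrt (H y))⁻¹) x (frame₁ x) = a₁
  generalize fderiv ℝ (fun y => (Real.sqrt (H y))⁻¹) x (frame₂ x) = a₂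
  generalize fderiv ℝ (fun y => (Real.sqrt (H y))⁻¹) x (frame₃ x) = a₃
  have hφ : (1 : ℝ) / H x ^ 2 = ((Real.sqrt (H x))⁻¹) ^ 4 := by
    rw [inv_pow, show (4 : ℕ) = 2 * 2 from rfl, pow_mul, Real.sq_sqrt hpos.le, one_div]
  rw [hφ, radial]
  generalize (Real.sqrt (H x))⁻¹ = φ
  have hn : dot x x = 1 := by rw [dot_self, hx, one_pow]
  -- Multiplying by `|x|⁴ = 1` makes both sides homogeneous of degree four in `x`; the identity is
  -- then polynomial. The radial components `aᵢ` cancel.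
  have : ∀ k : ℝ, k = k * dot x x ^ 2 := fun k => by rw [hn]; ring
  rw [this (1 / 2 * φ ^ 4)]
  simp [liouvilleWedge, liouville, symplectic, frame₁, frame₂, frame₃, dot]
  ring

/-- The point `(r₁², r₂²)`. -/
def moment (x : R4) : ℝ × ℝ := (x 0 ^ 2 + x 1 ^ 2, x 2 ^ 2 + x 3 ^ 2)

theorem moment_ne_zero {x : R4} (hx : x ≠ 0) : moment x ≠ 0 := by
  intro h
  have h1 := congrArg Prod.fst h
  have h2 := congrArg Prod.snd h
  simp only [moment, Prod.fst_zero, Prod.snd_zero] at h1 h2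
  have := dot_self_pos hx
  simp only [dot] at this
  linarith

theorem toricFunction_pos {F : ℝ × ℝ → ℝ} (hpos : ∀ v : ℝ × ℝ, v ≠ 0 → 0 < F v) {x : R4}
    (hx : x ≠ 0) : 0 < toricFunction F x := hpos _ (moment_ne_zero hx)

theorem toricFunction_smul {F : ℝ × ℝ → ℝ}
    (hhom : ∀ (t : ℝ) (v : ℝ × ℝ), 0 < t → F (t • v) = t * F v) {t : ℝ} (x : R4) (ht : t ≠ 0) :
    toricFunction F (t • x) = t ^ 2 * toricFunction F x := by
  rw [toricFunction, toricFunction, ← hhom (t ^ 2) _ (by positivity)]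
  congr 1
  simp only [PiLp.smul_apply, smul_eq_mul, Prod.smul_mk, Prod.mk.injEq]
  constructor <;> ring

theorem differentiableAt_toricFunction {F : ℝ × ℝ → ℝ} (hsmooth : ContDiffOn ℝ ∞ F {0}ᶜ) {x : R4}
    (hx : x ≠ 0) : DifferentiableAt ℝ (toricFunction F) x := by
  have h1 : DifferentiableAt ℝ F (moment x) :=
    (hsmooth.contDiffAt (isOpen_compl_singleton.mem_nhds (moment_ne_zero hx))).differentiableAt
      (by simp)
  have h2 : DifferentiableAt ℝ moment x := by unfold moment; fun_prop
  exact DifferentiableAt.comp x h1 h2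

/-- The contact volume of a toric domain. -/
theorem contactVolume_toricFunction {F : ℝ × ℝ → ℝ} (hsmooth : ContDiffOn ℝ ∞ F {0}ᶜ)
    (hpos : ∀ v : ℝ × ℝ, v ≠ 0 → 0 < F v)
    (hhom : ∀ (t : ℝ) (v : ℝ × ℝ), 0 < t → F (t • v) = t * F v) :
    IntegrableOn (fun m => 1 / F (1, m) ^ 2) (Ioi 0) ∧
      contactVolume (toricFunction F) =
        Real.pi ^ 2 * ∫ m in Ioi (0 : ℝ), 1 / F (1, m) ^ 2 := by
  have hF : Measurable F := measurable_of_continuousOn_compl_singleton 0 hsmooth.continuousOn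
  have hH : Measurable (toricFunction F) := by unfold toricFunction; fun_prop
  have hne : ∀ x : Metric.sphere (0 : R4) 1, (x : R4) ≠ 0 :=
    fun x => Metric.ne_of_mem_sphere x.2 one_ne_zero
  set σ := (volume : Measure R4).toSphere
  have hcont : Continuous fun x : Metric.sphere (0 : R4) 1 =>
      1 / 2 * (1 / toricFunction F x ^ 2) := by
    have : Continuous fun x : Metric.sphere (0 : R4) 1 => toricFunction F x :=
      continuous_iff_continuousAt.2 fun x =>
        (differentiableAt_toricFunction hsmooth (hne x)).continuousAt.comp
          continuous_subtype_val.continuousAt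
    exact continuous_const.mul (continuous_const.div (this.pow 2) fun x =>
      (pow_pos (toricFunction_pos hpos (hne x)) 2).ne')
  have hnn : ∀ x : Metric.sphere (0 : R4) 1, 0 ≤ 1 / 2 * (1 / toricFunction F x ^ 2) :=
    fun x => by positivity
  have hSint : Integrable (fun x : Metric.sphere (0 : R4) 1 =>
      1 / 2 * (1 / toricFunction F x ^ 2)) σ :=
    hcont.integrable_of_hasCompactSupport (HasCompactSupport.of_compactSpace _)
  have hvol : contactVolume (toricFunction F) =
      ∫ x : Metric.sphere (0 : R4) 1, 1 / 2 * (1 / toricFunction F x ^ 2) ∂σ := by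
    refine integral_congr_ae (Eventually.of_forall fun x => ?_)
    exact liouvilleWedge_radial (by simp) (differentiableAt_toricFunction hsmooth (hne x))
      (toricFunction_pos hpos (hne x))
  -- Both sides are the integral of `exp (-H)` over `ℝ⁴`, on the left in spherical coordinates, on
  -- the right in `R = r₁²` and `m = r₂² / r₁²`.
  have hchain : ENNReal.ofReal (∫ x : Metric.sphere (0 : R4) 1,
      1 / 2 * (1 / toricFunction F x ^ 2) ∂σ) = ENNReal.ofReal (Real.pi ^ 2) *
        ∫⁻ m in Ioi (0 : ℝ), ENNReal.ofReal (1 / F (1, m) ^ 2) := by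
    rw [ofReal_integral_eq_lintegral_ofReal hSint (Eventually.of_forall hnn),
      ← lintegral_exp_neg_eq_sphere hH (fun x hx => toricFunction_pos hpos hx)
        (fun t x ht => toricFunction_smul hhom x ht.ne'), ← lintegral_quadrant hF hpos hhom]
    exact lintegral_toric (φ := fun z => ENNReal.ofReal (Real.exp (-F z))) (by fun_prop)
  have hpi2 : 0 < Real.pi ^ 2 := by positivity
  -- The sphere integral is finite, which yields integrability on the half-line.
  have hfin : ∫⁻ m in Ioi (0 : ℝ), ENNReal.ofReal (1 / F (1, m) ^ 2) ≠ ⊤ := by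
    intro htop
    rw [htop, ENNReal.mul_top (ENNReal.ofReal_pos.2 hpi2).ne'] at hchain
    exact ENNReal.ofReal_ne_top hchain
  have hmeas : Measurable fun m => 1 / F (1, m) ^ 2 := by fun_prop
  have hwint : IntegrableOn (fun m => 1 / F (1, m) ^ 2) (Ioi 0) := by
    refine ⟨hmeas.aestronglyMeasurable, ?_⟩
    rw [hasFiniteIntegral_iff_ofReal (Eventually.of_forall fun m => by simp only [Pi.zero_apply]; positivity)]
    exact lt_top_iff_ne_top.2 hfin
  refine ⟨hwint, ?_⟩
  rw [← ofReal_integral_eq_lintegral_ofReal hwint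
    (Eventually.of_forall fun m => by simp only [Pi.zero_apply]; positivity),
    ← ENNReal.ofReal_mul hpi2.le] at hchain
  rw [hvol]
  refine (ENNReal.ofReal_eq_ofReal_iff (integral_nonneg hnn) ?_).1 hchain
  exact mul_nonneg hpi2.le (integral_nonneg fun m => by simp only [Pi.zero_apply]; positivity)

/-! ### The Reeb flow of a toric domain and its closed orbits. -/

variable {F : ℝ × ℝ → ℝ}

theorem differentiableAt_of_contDiffOn (hsmooth : ContDiffOn ℝ ∞ F {0}ᶜ) {v : ℝ × ℝ} (hv : v ≠ 0) :
    DifferentiableAt ℝ F v :=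
  (hsmooth.contDiffAt (isOpen_compl_singleton.mem_nhds hv)).differentiableAt (by simp)

/-- The partial derivative in the first variable. -/
def partial₁ (F : ℝ × ℝ → ℝ) (v : ℝ × ℝ) : ℝ := fderiv ℝ F v (1, 0)

/-- The partial derivative in the second variable. -/
def partial₂ (F : ℝ × ℝ → ℝ) (v : ℝ × ℝ) : ℝ := fderiv ℝ F v (0, 1)

theorem fderiv_eq_partial (v w : ℝ × ℝ) :
    fderiv ℝ F v w = w.1 * partial₁ F v + w.2 * partial₂ F v := by
  have : w = w.1 • ((1, 0) : ℝ × ℝ) + w.2 • ((0, 1) : ℝ × ℝ) := by ext <;> simp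
  conv_lhs => rw [this]
  rw [map_add, map_smul, map_smul]; rfl

/-- Euler's identity. -/
theorem euler_identity (hsmooth : ContDiffOn ℝ ∞ F {0}ᶜ)
    (hhom : ∀ (t : ℝ) (v : ℝ × ℝ), 0 < t → F (t • v) = t * F v) {v : ℝ × ℝ} (hv : v ≠ 0) :
    v.1 * partial₁ F v + v.2 * partial₂ F v = F v := by
  rw [← fderiv_eq_partial]
  have h1 : HasDerivAt (fun t : ℝ => t • v) v 1 := by
    simpa using (hasDerivAt_id (1 : ℝ)).smul_const v
  have hF : HasFDerivAt F (fderiv ℝ F v) ((1 : ℝ) • v) := by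
    rw [one_smul]; exact (differentiableAt_of_contDiffOn hsmooth hv).hasFDerivAt
  have h2 := hF.comp_hasDerivAt (1 : ℝ) h1
  have h3 : HasDerivAt (fun t : ℝ => t * F v) (F v) 1 := by
    simpa using (hasDerivAt_id (1 : ℝ)).mul_const (F v)
  refine h2.unique (h3.congr_of_eventuallyEq ?_)
  filter_upwards [Ioi_mem_nhds (zero_lt_one' ℝ)] with t ht using hhom t v ht

/-- The derivative has degree zero, so the Reeb frequencies at a boundary point can be read off at
`(1, m)` on the same ray. -/
theorem fderiv_smul_of_homogeneous
    (hhom : ∀ (t : ℝ) (v : ℝ × ℝ), 0 < t → F (t • v) = t * F v) {t : ℝ} (ht : 0 < t) (v : ℝ × ℝ) :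
    fderiv ℝ F (t • v) = fderiv ℝ F v := by
  have h1 : (fun w => F (t • w)) = t • F := funext fun w => hhom t w ht
  have h2 := fderiv_comp_smul (𝕜 := ℝ) (f := F) (x := v) t
  rw [h1, fderiv_const_smul_field] at h2
  exact (smul_right_injective _ ht.ne' h2).symm

/-- The value of the toric vector field at a point. -/
theorem isReebVector_toric (hsmooth : ContDiffOn ℝ ∞ F {0}ᶜ)
    (hhom : ∀ (t : ℝ) (v : ℝ × ℝ), 0 < t → F (t • v) = t * F v) {x : R4} (hx : x ≠ 0)
    (hx1 : toricFunction F x = 1) :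
    IsReebVector (toricFunction F) x
      (rotGen (2 * partial₁ F (moment x)) (2 * partial₂ F (moment x)) x) := by
  have hm := moment_ne_zero hx
  have hfd : ∀ w : R4, fderiv ℝ (toricFunction F) x w =
      2 * (x 0 * w 0 + x 1 * w 1) * partial₁ F (moment x) +
        2 * (x 2 * w 2 + x 3 * w 3) * partial₂ F (moment x) := by
    intro w
    have hc : HasDerivAt (fun t : ℝ => x + t • w) w 0 := by
      simpa using ((hasDerivAt_id (0 : ℝ)).smul_const w).const_add x
    have hH : HasFDerivAt (toricFunction F) (fderiv ℝ (toricFunction F) x) (x + (0 : ℝ) • w) := by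
      rw [zero_smul, add_zero]; exact (differentiableAt_toricFunction hsmooth hx).hasFDerivAt
    have h1 := hH.comp_hasDerivAt (0 : ℝ) hc
    rw [hasDerivAt_R4] at hc
    have hmom : HasDerivAt (fun t : ℝ => moment (x + t • w))
        (2 * (x 0 * w 0 + x 1 * w 1), 2 * (x 2 * w 2 + x 3 * w 3)) 0 := by
      refine HasDerivAt.prodMk ?_ ?_
      · exact (((hc 0).pow 2).add ((hc 1).pow 2)).congr_deriv (by simp; ring)
      · exact (((hc 2).pow 2).add ((hc 3).pow 2)).congr_deriv (by simp; ring)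
    have hF : HasFDerivAt F (fderiv ℝ F (moment x)) (moment (x + (0 : ℝ) • w)) := by
      rw [zero_smul, add_zero]; exact (differentiableAt_of_contDiffOn hsmooth hm).hasFDerivAt
    have h2 := hF.comp_hasDerivAt (0 : ℝ) hmom
    rw [h1.unique h2, fderiv_eq_partial]
  have heul := euler_identity hsmooth hhom hm
  have hone : F (moment x) = 1 := hx1
  rw [hone] at heul
  generalize partial₁ F (moment x) = A at *
  generalize partial₂ F (moment x) = B at *
  refine ⟨?_, ?_, ?_⟩
  · rw [hfd]; simp [rotGen]; ring
  · simp only [moment] at heul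
    simp [liouville, rotGen]
    linear_combination heul
  · intro w hw
    rw [hfd] at hw
    simp [symplectic, rotGen]
    linear_combination -hw

/-- The dilations `t • x` with `t > 1` leave the domain and converge to `x`. -/
theorem mem_frontier_domain
    (hhom : ∀ (t : ℝ) (v : ℝ × ℝ), 0 < t → F (t • v) = t * F v) {x : R4}
    (hx1 : toricFunction F x = 1) : x ∈ frontier (domain (toricFunction F)) := by
  rw [frontier_eq_closure_inter_closure]
  refine ⟨subset_closure hx1.le, ?_⟩
  have ht : Tendsto (fun t : ℝ => t • x) (𝓝[>] 1) (𝓝 x) := by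
    have : Tendsto (fun t : ℝ => t • x) (𝓝 1) (𝓝 ((1 : ℝ) • x)) :=
      (continuous_id.smul continuous_const).tendsto 1
    rw [one_smul] at this
    exact this.mono_left nhdsWithin_le_nhds
  refine mem_closure_of_tendsto ht ?_
  filter_upwards [self_mem_nhdsWithin] with t ht
  have ht1 : 1 < t := ht
  simp only [domain, mem_compl_iff, mem_ofPred_eq, not_le]
  rw [toricFunction_smul hhom x (by positivity), hx1, mul_one]
  nlinarith

theorem moment_torusCurve (a b : ℝ) (p : R4) (t : ℝ) : moment (torusCurve a b p t) = moment p := by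
  have h1 := Real.cos_sq_add_sin_sq (a * t)
  have h2 := Real.cos_sq_add_sin_sq (b * t)
  simp only [moment, torusCurve, Prod.mk.injEq]
  constructor
  · simp; linear_combination (p 0 ^ 2 + p 1 ^ 2) * h1
  · simp; linear_combination (p 2 ^ 2 + p 3 ^ 2) * h2

theorem ne_zero_of_toricFunction_eq_one
    (hhom : ∀ (t : ℝ) (v : ℝ × ℝ), 0 < t → F (t • v) = t * F v) {x : R4}
    (hx1 : toricFunction F x = 1) : x ≠ 0 := by
  rintro rfl
  have := toricFunction_smul hhom (0 : R4) (two_ne_zero' ℝ)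
  rw [smul_zero, hx1] at this
  norm_num at this

/-- The Reeb orbit through a point of the boundary, if it closes up. -/
def torusOrbit (hsmooth : ContDiffOn ℝ ∞ F {0}ᶜ)
    (hhom : ∀ (t : ℝ) (v : ℝ × ℝ), 0 < t → F (t • v) = t * F v) (p : R4)
    (hp : toricFunction F p = 1) (T : ℝ) (hT : 0 < T)
    (hper : Function.Periodic
      (torusCurve (2 * partial₁ F (moment p)) (2 * partial₂ F (moment p)) p) T) :
    PeriodicOrbit (toricFunction F) where
  curve := torusCurve (2 * partial₁ F (moment p)) (2 * partial₂ F (moment p)) p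
  period := T
  period_pos := hT
  mem_boundary t := mem_frontier_domain hhom <| by
    rw [← hp]; exact congrArg F (moment_torusCurve _ _ p t)
  reeb t := by
    have h1 : toricFunction F
        (torusCurve (2 * partial₁ F (moment p)) (2 * partial₂ F (moment p)) p t) = 1 := by
      rw [← hp]; exact congrArg F (moment_torusCurve _ _ p t)
    refine ⟨_, ?_, hasDerivAt_torusCurve _ _ p t⟩
    have := isReebVector_toric hsmooth hhom (ne_zero_of_toricFunction_eq_one hhom h1) h1
    rwa [moment_torusCurve] at this
  periodic := hper

/-- A zero would make `x` and `y` positive multiples of each other, hence equal, since `H = 1` at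
both. Thus the Gauss integrand is regular for disjoint orbits. -/
theorem joinPt_ne_zero (hhom : ∀ (t : ℝ) (v : ℝ × ℝ), 0 < t → F (t • v) = t * F v) {x y : R4}
    (hx : toricFunction F x = 1) (hy : toricFunction F y = 1) (hxy : x ≠ y) {u : ℝ}
    (hu : u ∈ Icc 0 (Real.pi / 2)) : joinPt x y u ≠ 0 := by
  intro h
  have hpi := Real.pi_pos
  have hx0 := ne_zero_of_toricFunction_eq_one hhom hx
  have hy0 := ne_zero_of_toricFunction_eq_one hhom hy
  have hc0 : 0 ≤ Real.cos u := Real.cos_nonneg_of_mem_Icc ⟨by linarith [hu.1], hu.2⟩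
  have hs0 : 0 ≤ Real.sin u := Real.sin_nonneg_of_nonneg_of_le_pi hu.1 (by linarith [hu.2])
  have hcs := Real.cos_sq_add_sin_sq u
  have he : Real.cos u • x = Real.sin u • y := sub_eq_zero.1 h
  have hc : Real.cos u ≠ 0 := fun hc => by
    rw [hc, zero_smul] at he
    rcases smul_eq_zero.1 he.symm with hs | hs
    · rw [hc, hs] at hcs; norm_num at hcs
    · exact hy0 hs
  have hs : Real.sin u ≠ 0 := fun hs => by
    rw [hs, zero_smul] at he
    exact (smul_ne_zero hc hx0) he
  have h2 := congrArg (toricFunction F) he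
  rw [toricFunction_smul hhom x hc, toricFunction_smul hhom y hs, hx, hy, mul_one, mul_one] at h2
  have h3 : Real.cos u = Real.sin u := (pow_left_inj₀ hc0 hs0 two_ne_zero).1 h2
  rw [h3] at he
  exact hxy (smul_right_injective _ hs he)

/-- A plane in which `p` vanishes imposes no condition on its frequency; this is what closes the
orbits in the coordinate planes. -/
theorem torusCurve_periodic {a b T : ℝ} {p : R4}
    (ha : (p 0 = 0 ∧ p 1 = 0) ∨ ∃ k : ℤ, a * T = k * (2 * Real.pi))
    (hb : (p 2 = 0 ∧ p 3 = 0) ∨ ∃ k : ℤ, b * T = k * (2 * Real.pi)) :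
    Function.Periodic (torusCurve a b p) T := by
  have key : ∀ (c : ℝ) (k : ℤ), c * T = k * (2 * Real.pi) → ∀ t,
      Real.cos (c * (t + T)) = Real.cos (c * t) ∧ Real.sin (c * (t + T)) = Real.sin (c * t) := by
    intro c k h t
    rw [mul_add, h, Real.cos_add_int_mul_two_pi, Real.sin_add_int_mul_two_pi]
    exact ⟨rfl, rfl⟩
  intro t
  ext i
  rcases ha with ⟨h0, h1⟩ | ⟨k, hk⟩ <;> rcases hb with ⟨h2, h3⟩ | ⟨l, hl⟩
  · fin_cases i <;> simp [torusCurve, h0, h1, h2, h3]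
  · fin_cases i <;> simp [torusCurve, h0, h1, key b l hl t]
  · fin_cases i <;> simp [torusCurve, h2, h3, key a k hk t]
  · fin_cases i <;> simp [torusCurve, key a k hk t, key b l hl t]

/-! ### Pairings with the orbit in the plane `z₂ = 0`. -/

theorem systolicPairing_eq {H : R4 → ℝ} {γ₁ γ₂ : PeriodicOrbit H} {K V : ℝ}
    (hlink : linkingNumber γ₁.curve γ₂.curve γ₁.period γ₂.period =
      γ₁.period * γ₂.period * K / (4 * Real.pi ^ 2))
    (hvol : contactVolume H = Real.pi ^ 2 * V) : systolicPairing γ₁ γ₂ = K * V / 4 := by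
  have h1 := γ₁.period_pos
  have h2 := γ₂.period_pos
  have hpi := Real.pi_pos
  rw [systolicPairing, hlink, hvol]
  field_simp

theorem continuous_rotGen (a b : ℝ) : Continuous (rotGen a b) := by
  unfold rotGen; fun_prop

/-- The pairing of the orbit in the plane `z₂ = 0` with an orbit on a resonant torus. -/
theorem exists_systolicPairing_eq {F : ℝ × ℝ → ℝ} (hsmooth : ContDiffOn ℝ ∞ F {0}ᶜ)
    (hpos : ∀ v : ℝ × ℝ, v ≠ 0 → 0 < F v)
    (hhom : ∀ (t : ℝ) (v : ℝ × ℝ), 0 < t → F (t • v) = t * F v) {V : ℝ}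
    (hvol : contactVolume (toricFunction F) = Real.pi ^ 2 * V) {m : ℝ} (hm : 0 < m)
    (hres : Resonant (partial₁ F (1, m)) (partial₂ F (1, m))) :
    ∃ γ₁ γ₂ : PeriodicOrbit (toricFunction F), GeomDistinct γ₁ γ₂ ∧
      systolicPairing γ₁ γ₂ = partial₂ F (1, m) * F (1, 0) * V := by
  have hpi := Real.pi_pos
  have hg₀ : 0 < F (1, 0) := hpos _ (by simp)
  have hg : 0 < F (1, m) := hpos _ (by simp)
  -- `p` and `q` are the boundary points with moments on the rays through `(1, 0)` and `(1, m)`.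
  set p : R4 := !₂[√(1 / F (1, 0)), 0, 0, 0] with hp
  set q : R4 := !₂[√(1 / F (1, m)), 0, √(m / F (1, m)), 0] with hq
  have hmp : moment p = (1 / F (1, 0)) • ((1, 0) : ℝ × ℝ) := by
    simp [moment, hp, Real.sq_sqrt hg₀.le]
  have hmq : moment q = (1 / F (1, m)) • ((1, m) : ℝ × ℝ) := by
    simp [moment, hq, Real.sq_sqrt hg.le, Real.sq_sqrt (div_nonneg hm.le hg.le)]
    ring
  have hp1 : toricFunction F p = 1 := by
    change F (moment p) = 1
    rw [hmp, hhom _ _ (by positivity)]; field_simp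
  have hq1 : toricFunction F q = 1 := by
    change F (moment q) = 1
    rw [hmq, hhom _ _ (by positivity)]; field_simp
  have hp₁ : partial₁ F (moment p) = F (1, 0) := by
    rw [partial₁, hmp, fderiv_smul_of_homogeneous hhom (by positivity)]
    simpa [partial₁] using euler_identity hsmooth hhom (v := (1, 0)) (by simp)
  have hq₁ : partial₁ F (moment q) = partial₁ F (1, m) := by
    rw [partial₁, hmq, fderiv_smul_of_homogeneous hhom (by positivity)]; rfl
  have hq₂ : partial₂ F (moment q) = partial₂ F (1, m) := by
    rw [partial₂, hmq, fderiv_smul_of_homogeneous hhom (by positivity)]; rfl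
  obtain ⟨T, hT, k, l, hk, hl⟩ := hres
  have hper₁ : Function.Periodic (torusCurve (2 * partial₁ F (moment p))
      (2 * partial₂ F (moment p)) p) (Real.pi / F (1, 0)) :=
    torusCurve_periodic (Or.inr ⟨1, by rw [hp₁]; push_cast; field_simp⟩)
      (Or.inl (by simp [hp]))
  have hper₂ : Function.Periodic (torusCurve (2 * partial₁ F (moment q))
      (2 * partial₂ F (moment q)) q) T :=
    torusCurve_periodic (Or.inr ⟨k, by rw [hq₁, hk]⟩) (Or.inr ⟨l, by rw [hq₂, hl]⟩)
  set γ₁ := torusOrbit hsmooth hhom p hp1 (Real.pi / F (1, 0)) (by positivity) hper₁ with hγ₁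
  set γ₂ := torusOrbit hsmooth hhom q hq1 T hT hper₂ with hγ₂
  have hne : ∀ s t, γ₁.curve s ≠ γ₂.curve t := by
    intro s t h
    have h1 : moment p = moment q := by
      rw [← moment_torusCurve (2 * partial₁ F (moment p)) (2 * partial₂ F (moment p)) p s,
        ← moment_torusCurve (2 * partial₁ F (moment q)) (2 * partial₂ F (moment q)) q t]
      exact congrArg moment h
    rw [hmp, hmq] at h1
    have h2 := congrArg Prod.snd h1
    simp only [Prod.smul_mk, smul_eq_mul, mul_zero] at h2
    have : 0 < 1 / F (1, m) * m := by positivity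
    linarith
  refine ⟨γ₁, γ₂, fun h => ?_, ?_⟩
  · obtain ⟨t, ht⟩ : γ₁.curve 0 ∈ range γ₂.curve := h ▸ mem_range_self 0
    exact hne 0 t ht.symm
  · rw [systolicPairing_eq (K := 2 * partial₂ F (1, m) * (2 * F (1, 0))) (V := V) ?_ hvol]
    · ring
    · have hc2 : ∀ s, γ₁.curve s 2 = 0 ∧ γ₁.curve s 3 = 0 := fun s => by
        simp [hγ₁, torusOrbit, torusCurve, hp]
      -- In the plane `z₂ = 0` only the first angular velocity acts, so `κ = ∂₁F (1, m) / F (1, 0)`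
      -- matches the two speeds; it may be zero or negative. There `wedge` keeps only its `dx₁ ∧
      -- dy₁` term, which gives `K` as the second velocity of `γ₂` times the speed of `γ₁`.
      have key := linkingNumber_eq (c₁ := γ₁.curve)
        (c₁' := fun s => rotGen (2 * partial₁ F (moment p)) (2 * partial₂ F (moment p))
          (γ₁.curve s)) (2 * partial₁ F (moment q)) (2 * partial₂ F (moment q))
        (partial₁ F (1, m) / F (1, 0)) (2 * partial₂ F (1, m) * (2 * F (1, 0))) q
        (T₁ := γ₁.period) (T₂ := γ₂.period) γ₁.period_pos.le
        (fun s => hasDerivAt_torusCurve _ _ p s)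
        ((continuous_rotGen _ _).comp (continuous_torusCurve _ _ p)) γ₁.periodic ?_ ?_ ?_
      · exact key
      · intro s
        rw [hp₁, hq₁]
        ext i
        fin_cases i <;> simp [rotGen, hc2 s] <;> field_simp
      · intro s
        rw [hp₁, hq₁, hq₂]
        simp [wedge, rotGen, dot, hc2 s]
        ring
      · intro s t u hu
        refine joinPt_ne_zero hhom ?_ ?_ (hne s t) hu
        · rw [← hp1]; exact congrArg F (moment_torusCurve _ _ p s)
        · rw [← hq1]; exact congrArg F (moment_torusCurve _ _ q t)

/-! ### Ellipsoids: linear Reeb flow and constant pairing. -/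

/-- The function `A r₁² + B r₂²`. -/
def ellipsoidFunction (A B : ℝ) (p : R4) : ℝ :=
  A * (p 0 ^ 2 + p 1 ^ 2) + B * (p 2 ^ 2 + p 3 ^ 2)

theorem continuous_ellipsoidFunction (A B : ℝ) : Continuous (ellipsoidFunction A B) := by
  unfold ellipsoidFunction; fun_prop

theorem fderiv_ellipsoidFunction (A B : ℝ) (x w : R4) :
    fderiv ℝ (ellipsoidFunction A B) x w =
      2 * A * (x 0 * w 0 + x 1 * w 1) + 2 * B * (x 2 * w 2 + x 3 * w 3) := by
  have hd : DifferentiableAt ℝ (ellipsoidFunction A B) (x + (0 : ℝ) • w) := by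
    unfold ellipsoidFunction; fun_prop
  have hc : HasDerivAt (fun t : ℝ => x + t • w) w 0 := by
    simpa using ((hasDerivAt_id (0 : ℝ)).smul_const w).const_add x
  have h1 := hd.hasFDerivAt.comp_hasDerivAt (0 : ℝ) hc
  rw [zero_smul, add_zero] at h1
  rw [hasDerivAt_R4] at hc
  refine h1.unique (((((hc 0).pow 2).add ((hc 1).pow 2)).const_mul A).add
    ((((hc 2).pow 2).add ((hc 3).pow 2)).const_mul B) |>.congr_deriv ?_)
  simp; ring

theorem eq_one_of_mem_frontier_ellipsoid {A B : ℝ} {x : R4}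
    (hx : x ∈ frontier (domain (ellipsoidFunction A B))) : ellipsoidFunction A B x = 1 :=
  frontier_le_subset_eq (continuous_ellipsoidFunction A B) continuous_const hx

/-- The Reeb vector field of an ellipsoid is linear. -/
theorem IsReebVector.eq_rotGen {A B : ℝ} {x v : R4} (hx : ellipsoidFunction A B x = 1)
    (hv : IsReebVector (ellipsoidFunction A B) x v) : v = rotGen (2 * A) (2 * B) x := by
  obtain ⟨-, h1, h2⟩ := hv
  have hxx : fderiv ℝ (ellipsoidFunction A B) x x = 2 := by
    rw [fderiv_ellipsoidFunction]
    unfold ellipsoidFunction at hx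
    linear_combination 2 * hx
  -- Subtracting a multiple of the radial vector makes `w` tangent, as `dH(x) = 2`; and `ω₀(v, x) =
  -- -2 λ₀(v) = -2`.
  have key : ∀ w, symplectic v w = -fderiv ℝ (ellipsoidFunction A B) x w := by
    intro w
    have h3 := h2 (w - (fderiv ℝ (ellipsoidFunction A B) x w / 2) • x) (by
      rw [map_sub, map_smul, hxx, smul_eq_mul]; ring)
    generalize fderiv ℝ (ellipsoidFunction A B) x w = d at *
    simp only [symplectic, liouville, PiLp.sub_apply, PiLp.smul_apply, smul_eq_mul] at *
    linear_combination h3 - d * h1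
  have k0 := key (EuclideanSpace.single 0 1)
  have k1 := key (EuclideanSpace.single 1 1)
  have k2 := key (EuclideanSpace.single 2 1)
  have k3 := key (EuclideanSpace.single 3 1)
  rw [fderiv_ellipsoidFunction] at k0 k1 k2 k3
  simp [symplectic] at k0 k1 k2 k3
  ext i
  fin_cases i <;> simp [rotGen] <;> linarith

/-- Rotating the solution back by the angle `a t` gives constants. -/
theorem rotation_unique {a : ℝ} {f g : ℝ → ℝ} (hf : ∀ t, HasDerivAt f (-(a * g t)) t)
    (hg : ∀ t, HasDerivAt g (a * f t) t) (t : ℝ) :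
    f t = Real.cos (a * t) * f 0 - Real.sin (a * t) * g 0 ∧
      g t = Real.sin (a * t) * f 0 + Real.cos (a * t) * g 0 := by
  have hs : ∀ t, HasDerivAt (fun t => Real.sin (a * t)) (Real.cos (a * t) * a) t := fun t => by
    simpa using ((hasDerivAt_id t).const_mul a).sin
  have hc : ∀ t, HasDerivAt (fun t => Real.cos (a * t)) (-Real.sin (a * t) * a) t := fun t => by
    simpa using ((hasDerivAt_id t).const_mul a).cos
  have h1 : ∀ t, HasDerivAt (fun t => Real.cos (a * t) * f t + Real.sin (a * t) * g t) 0 t :=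
    fun t => (((hc t).mul (hf t)).add ((hs t).mul (hg t))).congr_deriv (by ring)
  have h2 : ∀ t, HasDerivAt (fun t => Real.cos (a * t) * g t - Real.sin (a * t) * f t) 0 t :=
    fun t => (((hc t).mul (hg t)).sub ((hs t).mul (hf t))).congr_deriv (by ring)
  have e1 := is_const_of_deriv_eq_zero (fun t => (h1 t).differentiableAt) (fun t => (h1 t).deriv) t 0
  have e2 := is_const_of_deriv_eq_zero (fun t => (h2 t).differentiableAt) (fun t => (h2 t).deriv) t 0
  simp only [mul_zero, Real.cos_zero, Real.sin_zero, one_mul, zero_mul, add_zero, sub_zero] at e1 e2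
  have := Real.cos_sq_add_sin_sq (a * t)
  constructor
  · linear_combination Real.cos (a * t) * e1 - Real.sin (a * t) * e2 - f t * this
  · linear_combination Real.sin (a * t) * e1 + Real.cos (a * t) * e2 - g t * this

/-- The only solutions of the linear equation `c' = rotGen a b c` are the torus curves. -/
theorem eq_torusCurve {a b : ℝ} {c : ℝ → R4} (hc : ∀ t, HasDerivAt c (rotGen a b (c t)) t) :
    c = torusCurve a b (c 0) := by
  simp only [hasDerivAt_R4] at hc
  have h1 := rotation_unique (a := a) (f := fun t => c t 0) (g := fun t => c t 1)
    (fun t => by simpa [rotGen] using hc t 0) (fun t => by simpa [rotGen] using hc t 1)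
  have h2 := rotation_unique (a := b) (f := fun t => c t 2) (g := fun t => c t 3)
    (fun t => by simpa [rotGen] using hc t 2) (fun t => by simpa [rotGen] using hc t 3)
  funext t
  ext i
  fin_cases i
  · simpa [torusCurve] using (h1 t).1
  · simpa [torusCurve] using (h1 t).2
  · simpa [torusCurve] using (h2 t).1
  · simpa [torusCurve] using (h2 t).2

theorem PeriodicOrbit.hasDerivAt_ellipsoid {A B : ℝ}
    (γ : PeriodicOrbit (ellipsoidFunction A B)) (t : ℝ) :
    HasDerivAt γ.curve (rotGen (2 * A) (2 * B) (γ.curve t)) t := by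
  obtain ⟨v, hv, hd⟩ := γ.reeb t
  rwa [← hv.eq_rotGen (eq_one_of_mem_frontier_ellipsoid (γ.mem_boundary t))]

/-- A periodic orbit is determined by any of its points. -/
theorem PeriodicOrbit.range_subset_ellipsoid {A B : ℝ}
    {γ₁ γ₂ : PeriodicOrbit (ellipsoidFunction A B)} {s t : ℝ} (h : γ₁.curve s = γ₂.curve t) :
    range γ₁.curve ⊆ range γ₂.curve := by
  have shift : ∀ (γ : PeriodicOrbit (ellipsoidFunction A B)) (s : ℝ),
      (fun r => γ.curve (s + r)) = torusCurve (2 * A) (2 * B) (γ.curve s) := by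
    intro γ s
    have := eq_torusCurve (c := fun r => γ.curve (s + r))
      fun r => (γ.hasDerivAt_ellipsoid (s + r)).comp_const_add s r
    simpa using this
  rintro _ ⟨r, rfl⟩
  refine ⟨t + (r - s), ?_⟩
  have h1 := congrFun (shift γ₁ s) (r - s)
  have h2 := congrFun (shift γ₂ t) (r - s)
  simp only [add_sub_cancel] at h1
  rw [h1, h2, h]

/-- On an ellipsoid, the systolic pairing is constant. -/
theorem systolicPairing_ellipsoid {A B : ℝ} {F : ℝ × ℝ → ℝ}
    (hhom : ∀ (t : ℝ) (v : ℝ × ℝ), 0 < t → F (t • v) = t * F v)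
    (hF : toricFunction F = ellipsoidFunction A B) {V : ℝ}
    (hvol : contactVolume (toricFunction F) = Real.pi ^ 2 * V)
    (γ₁ γ₂ : PeriodicOrbit (toricFunction F)) (hne : GeomDistinct γ₁ γ₂) :
    systolicPairing γ₁ γ₂ = A * B * V := by
  have hdist : ∀ s t, γ₁.curve s ≠ γ₂.curve t := by
    revert γ₁ γ₂
    rw [hF]
    intro γ₁ γ₂ hne s t h
    exact hne ((PeriodicOrbit.range_subset_ellipsoid h).antisymm
      (PeriodicOrbit.range_subset_ellipsoid h.symm))
  have hone : ∀ (γ : PeriodicOrbit (toricFunction F)) t, toricFunction F (γ.curve t) = 1 := by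
    rw [hF]; exact fun γ t => eq_one_of_mem_frontier_ellipsoid (γ.mem_boundary t)
  have hder : ∀ (γ : PeriodicOrbit (toricFunction F)) t,
      HasDerivAt γ.curve (rotGen (2 * A) (2 * B) (γ.curve t)) t := by
    rw [hF]; exact fun γ t => γ.hasDerivAt_ellipsoid t
  rw [systolicPairing_eq (K := 2 * A * (2 * B)) (V := V) ?_ hvol]
  · ring
  · have hcont : Continuous γ₁.curve :=
      continuous_iff_continuousAt.2 fun t => (hder γ₁ t).continuousAt
    rw [eq_torusCurve (hder γ₂)]
    -- Both orbits solve the same linear equation, so `κ = 1`.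
    refine linkingNumber_eq (2 * A) (2 * B) 1 _ _ γ₁.period_pos.le (hder γ₁)
      ((continuous_rotGen _ _).comp hcont) γ₁.periodic (fun s => one_smul _ _) (fun s => ?_) ?_
    · simp [wedge, rotGen, dot]; ring
    · intro s t u hu
      rw [← eq_torusCurve (hder γ₂)]
      exact joinPt_ne_zero hhom (hone γ₁ s) (hone γ₂ t) (hdist s t) hu

/-! ### The slice `m ↦ F (1, m)`, and ellipsoids as the domains with affine slice. -/

theorem hasDerivAt_slice (hsmooth : ContDiffOn ℝ ∞ F {0}ᶜ) (m : ℝ) :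
    HasDerivAt (fun m => F (1, m)) (partial₂ F (1, m)) m := by
  have h1 : HasDerivAt (fun m : ℝ => ((1 : ℝ), m)) (0, 1) m :=
    (hasDerivAt_const m 1).prodMk (hasDerivAt_id m)
  exact (differentiableAt_of_contDiffOn hsmooth
    (by simp : ((1 : ℝ), m) ≠ 0)).hasFDerivAt.comp_hasDerivAt m h1

theorem differentiable_partial₂_slice (hsmooth : ContDiffOn ℝ ∞ F {0}ᶜ) :
    Differentiable ℝ fun m => partial₂ F (1, m) := by
  intro m
  have h1 : ContDiffAt ℝ ∞ F (1, m) :=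
    hsmooth.contDiffAt (isOpen_compl_singleton.mem_nhds (by simp))
  have h2 : DifferentiableAt ℝ (fderiv ℝ F) (1, m) :=
    (h1.fderiv_right (m := 1) (by norm_cast)).differentiableAt one_ne_zero
  have h3 : DifferentiableAt ℝ (fun m : ℝ => ((1 : ℝ), m)) m := by fun_prop
  exact (DifferentiableAt.comp m h2 h3).clm_apply (differentiableAt_const _)

/-- By homogeneity `F (1, m) = m F (1 / m, 1)`, and the second factor tends to `F (0, 1) > 0`. -/
theorem tendsto_slice (hsmooth : ContDiffOn ℝ ∞ F {0}ᶜ)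
    (hpos : ∀ v : ℝ × ℝ, v ≠ 0 → 0 < F v)
    (hhom : ∀ (t : ℝ) (v : ℝ × ℝ), 0 < t → F (t • v) = t * F v) :
    Tendsto (fun m => F (1, m)) atTop atTop := by
  have h1 : Tendsto (fun m : ℝ => F (m⁻¹, 1)) atTop (𝓝 (F (0, 1))) :=
    (differentiableAt_of_contDiffOn hsmooth (by simp : ((0 : ℝ), (1 : ℝ)) ≠ 0)).continuousAt.tendsto.comp
      (tendsto_inv_atTop_zero.prodMk_nhds tendsto_const_nhds)
  refine (tendsto_id.atTop_mul_pos (hpos (0, 1) (by simp)) h1).congr' ?_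
  filter_upwards [eventually_gt_atTop 0] with m hm
  rw [id, ← hhom m _ hm]
  simp [hm.ne']

theorem integral_slice_pos (hpos : ∀ v : ℝ × ℝ, v ≠ 0 → 0 < F v)
    (hint : IntegrableOn (fun m => 1 / F (1, m) ^ 2) (Ioi 0)) :
    0 < ∫ m in Ioi (0 : ℝ), 1 / F (1, m) ^ 2 := by
  have hp : ∀ m : ℝ, 0 < 1 / F (1, m) ^ 2 := fun m => by
    have := hpos (1, m) (by simp)
    positivity
  rw [setIntegral_pos_iff_support_of_nonneg_ae (Eventually.of_forall fun m => (hp m).le) hint]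
  have : Function.support (fun m : ℝ => 1 / F (1, m) ^ 2) = univ :=
    eq_univ_of_forall fun m => (hp m).ne'
  rw [this, univ_inter, Real.volume_Ioi]
  exact ENNReal.zero_lt_top

/-- If the slice `m ↦ F (1, m)` has constant slope, then `F` is linear on the quadrant. -/
theorem toricFunction_eq_ellipsoidFunction (hsmooth : ContDiffOn ℝ ∞ F {0}ᶜ)
    (hhom : ∀ (t : ℝ) (v : ℝ × ℝ), 0 < t → F (t • v) = t * F v) {c : ℝ}
    (hc : ∀ m, 0 < m → partial₂ F (1, m) = c) :
    toricFunction F = ellipsoidFunction (F (1, 0)) c := by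
  have hslice : ∀ m, 0 ≤ m → F (1, m) = F (1, 0) + c * m := by
    have hd : ∀ m, HasDerivAt (fun m => F (1, m) - c * m) (partial₂ F (1, m) - c) m := fun m =>
      ((hasDerivAt_slice hsmooth m).sub ((hasDerivAt_id m).const_mul c)).congr_deriv (by ring)
    intro m hm
    have := constant_of_derivWithin_zero (f := fun m => F (1, m) - c * m) (a := 0) (b := m + 1)
      (fun x _ => (hd x).differentiableAt.differentiableWithinAt) (fun x hx => ?_) m
      ⟨hm, by linarith⟩
    · simp only [mul_zero, sub_zero] at this
      linarith
    · have hu := uniqueDiffOn_Icc (show (0 : ℝ) < m + 1 by linarith) x ⟨hx.1, hx.2.le⟩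
      rw [(hd x).hasDerivWithinAt.derivWithin hu]
      -- The slope is prescribed only for `m > 0`; its value at `0` follows by continuity.
      rcases hx.1.eq_or_lt with h0 | h0
      · have hcont := (differentiable_partial₂_slice hsmooth).continuous
        have hz : Tendsto (fun m => partial₂ F (1, m)) (𝓝[>] 0) (𝓝 c) :=
          tendsto_const_nhds.congr' <| by
            filter_upwards [self_mem_nhdsWithin] with y hy using (hc y hy).symm
        have := tendsto_nhds_unique hz (hcont.continuousAt.tendsto.mono_left nhdsWithin_le_nhds)
        rw [← h0, this, sub_self]
      · rw [hc x h0, sub_self]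
  have hquad : ∀ R S : ℝ, 0 < R → 0 ≤ S → F (R, S) = F (1, 0) * R + c * S := by
    intro R S hR hS
    have h1 : ((R, S) : ℝ × ℝ) = R • (1, S / R) := by simp [mul_div_cancel₀ _ hR.ne']
    rw [h1, hhom R _ hR, hslice _ (div_nonneg hS hR.le)]
    field_simp
  have hzero : F 0 = 0 := by
    have := hhom 2 0 two_pos
    rw [smul_zero] at this
    linarith
  -- The rays through `(1, m)` miss the axis `R = 0`, which is reached as a limit.
  have haxis : ∀ S : ℝ, 0 ≤ S → F (0, S) = c * S := by
    intro S hS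
    rcases hS.eq_or_lt with rfl | hS'
    · rw [mul_zero]; exact hzero
    have h1 : Tendsto (fun R : ℝ => F (R, S)) (𝓝[>] 0) (𝓝 (F (0, S))) := by
      have : Tendsto (fun R : ℝ => ((R, S) : ℝ × ℝ)) (𝓝[>] 0) (𝓝 (0, S)) :=
        ((continuous_id.prodMk continuous_const).tendsto 0).mono_left nhdsWithin_le_nhds
      exact (differentiableAt_of_contDiffOn hsmooth
        (by simp [hS'.ne'] : ((0 : ℝ), S) ≠ 0)).continuousAt.tendsto.comp this
    have h2 : Tendsto (fun R : ℝ => F (1, 0) * R + c * S) (𝓝[>] 0) (𝓝 (c * S)) := by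
      have : Continuous fun R : ℝ => F (1, 0) * R + c * S := by fun_prop
      simpa using (this.tendsto 0).mono_left nhdsWithin_le_nhds
    refine tendsto_nhds_unique h1 (h2.congr' ?_)
    filter_upwards [self_mem_nhdsWithin] with R hR using (hquad R S hR hS).symm
  funext p
  have hR : 0 ≤ p 0 ^ 2 + p 1 ^ 2 := by positivity
  have hS : 0 ≤ p 2 ^ 2 + p 3 ^ 2 := by positivity
  rw [toricFunction, ellipsoidFunction]
  rcases hR.eq_or_lt with h | h
  · rw [← h, haxis _ hS]; ring
  · exact hquad _ _ h hS

theorem isEllipsoid_ellipsoidFunction {A B : ℝ} (hA : 0 < A) (hB : 0 < B) :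
    IsEllipsoid (domain (ellipsoidFunction A B)) := by
  let sqr : Fin 4 → QuadraticForm ℝ R4 := fun i =>
    QuadraticMap.sq.comp (PiLp.proj 2 (fun _ : Fin 4 => ℝ) i : R4 →L[ℝ] ℝ).toLinearMap
  have hsq : ∀ i p, sqr i p = p i ^ 2 := fun i p => by simp [sqr, sq]
  have hQ : ∀ p, (A • (sqr 0 + sqr 1) + B • (sqr 2 + sqr 3)) p = ellipsoidFunction A B p := by
    intro p
    simp [hsq, ellipsoidFunction, mul_add]
  refine ⟨A • (sqr 0 + sqr 1) + B • (sqr 2 + sqr 3), fun p hp => ?_, ?_⟩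
  · rw [hQ]
    have h0 := dot_self_pos hp
    simp only [dot] at h0
    have : 0 ≤ A * (p 0 ^ 2 + p 1 ^ 2) := by positivity
    have : 0 ≤ B * (p 2 ^ 2 + p 3 ^ 2) := by positivity
    rcases (show 0 ≤ p 0 ^ 2 + p 1 ^ 2 by positivity).eq_or_lt with h | h
    · have : 0 < B * (p 2 ^ 2 + p 3 ^ 2) := mul_pos hB (by nlinarith)
      unfold ellipsoidFunction; linarith
    · have : 0 < A * (p 0 ^ 2 + p 1 ^ 2) := mul_pos hA h
      unfold ellipsoidFunction; linarith
  · ext p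
    simp only [domain, mem_ofPred_eq, hQ]

/-- A toric function whose sublevel set is an ellipsoid has slices of constant slope. -/
theorem exists_slope_of_isEllipsoid (hsmooth : ContDiffOn ℝ ∞ F {0}ᶜ)
    (hpos : ∀ v : ℝ × ℝ, v ≠ 0 → 0 < F v)
    (hhom : ∀ (t : ℝ) (v : ℝ × ℝ), 0 < t → F (t • v) = t * F v)
    (hW : IsEllipsoid (domain (toricFunction F))) :
    ∃ c, ∀ m, 0 < m → partial₂ F (1, m) = c := by
  obtain ⟨Q, hQ, hdom⟩ := hW
  have hiff : ∀ p, toricFunction F p ≤ 1 ↔ Q p ≤ 1 := fun p => by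
    simpa [domain] using Set.ext_iff.1 hdom p
  have hQs : ∀ (t : ℝ) p, Q (t • p) = t ^ 2 * Q p := fun t p => by
    rw [QuadraticMap.map_smul, smul_eq_mul, sq]
  have hscale : ∀ h : ℝ, 0 < h → ((√h)⁻¹) ^ 2 = h⁻¹ ∧ (√h)⁻¹ ≠ 0 := fun h hh =>
    ⟨by rw [inv_pow, Real.sq_sqrt hh.le], (inv_pos.2 (Real.sqrt_pos.2 hh)).ne'⟩
  -- Both functions are homogeneous of degree two and positive off the origin, hence determined by
  -- their unit sublevel set.
  have heq : ∀ p, p ≠ 0 → toricFunction F p = Q p := by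
    intro p hp
    have h1 := toricFunction_pos hpos hp
    have h2 := hQ p hp
    refine le_antisymm ?_ ?_
    · have := (hiff ((√(Q p))⁻¹ • p)).2 (by
        rw [hQs, (hscale _ h2).1, inv_mul_cancel₀ h2.ne'])
      rwa [toricFunction_smul hhom _ (hscale _ h2).2, (hscale _ h2).1, inv_mul_le_one₀ h2] at this
    · have := (hiff ((√(toricFunction F p))⁻¹ • p)).1 (by
        rw [toricFunction_smul hhom _ (hscale _ h1).2, (hscale _ h1).1, inv_mul_cancel₀ h1.ne'])
      rwa [hQs, (hscale _ h1).1, inv_mul_le_one₀ h1] at this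
  set e : R4 := !₂[1, 0, 0, 0] with he
  set f : R4 := !₂[0, 0, 1, 0] with hf
  have hval : ∀ t : ℝ, F (1, t ^ 2) = Q (e + t • f) := by
    intro t
    rw [← heq]
    · simp [toricFunction, he, hf]
    · intro h
      have := congrArg (fun x : R4 => x 0) h
      simp [he, hf] at this
  -- `Q` is not assumed rotation invariant, but averaging its values at `e ± √m • f` cancels the
  -- cross term.
  have hslice : ∀ m, 0 < m → F (1, m) = Q e + Q f * m := by
    intro m hm
    have h1 := hval (√m)
    have h2 := hval (-√m)
    rw [neg_sq, Real.sq_sqrt hm.le, QuadraticMap.map_add Q, hQs, neg_sq, Real.sq_sqrt hm.le,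
      QuadraticMap.polar_smul_right] at h2
    rw [Real.sq_sqrt hm.le, QuadraticMap.map_add Q, hQs, Real.sq_sqrt hm.le,
      QuadraticMap.polar_smul_right] at h1
    simp only [smul_eq_mul] at h1 h2
    linarith
  refine ⟨Q f, fun m hm => (hasDerivAt_slice hsmooth m).unique ?_⟩
  have : HasDerivAt (fun m => Q e + Q f * m) (Q f) m := by
    simpa using ((hasDerivAt_id m).const_mul (Q f)).const_add (Q e)
  refine this.congr_of_eventuallyEq ?_
  filter_upwards [Ioi_mem_nhds hm] with x hx using hslice x hx

/-- The two orbits in the coordinate planes are geometrically distinct. -/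
theorem exists_geomDistinct (hsmooth : ContDiffOn ℝ ∞ F {0}ᶜ)
    (hpos : ∀ v : ℝ × ℝ, v ≠ 0 → 0 < F v)
    (hhom : ∀ (t : ℝ) (v : ℝ × ℝ), 0 < t → F (t • v) = t * F v) :
    ∃ γ₁ γ₂ : PeriodicOrbit (toricFunction F), GeomDistinct γ₁ γ₂ := by
  have hpi := Real.pi_pos
  have hA : 0 < F (1, 0) := hpos _ (by simp)
  have hB : 0 < F (0, 1) := hpos _ (by simp)
  set p : R4 := !₂[√(1 / F (1, 0)), 0, 0, 0] with hp
  set q : R4 := !₂[0, 0, √(1 / F (0, 1)), 0] with hq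
  have hmp : moment p = (1 / F (1, 0)) • ((1, 0) : ℝ × ℝ) := by
    simp [moment, hp, Real.sq_sqrt hA.le]
  have hmq : moment q = (1 / F (0, 1)) • ((0, 1) : ℝ × ℝ) := by
    simp [moment, hq, Real.sq_sqrt hB.le]
  have hp1 : toricFunction F p = 1 := by
    change F (moment p) = 1
    rw [hmp, hhom _ _ (by positivity)]; field_simp
  have hq1 : toricFunction F q = 1 := by
    change F (moment q) = 1
    rw [hmq, hhom _ _ (by positivity)]; field_simp
  have hp₁ : partial₁ F (moment p) = F (1, 0) := by
    rw [partial₁, hmp, fderiv_smul_of_homogeneous hhom (by positivity)]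
    simpa [partial₁] using euler_identity hsmooth hhom (v := (1, 0)) (by simp)
  have hq₂ : partial₂ F (moment q) = F (0, 1) := by
    rw [partial₂, hmq, fderiv_smul_of_homogeneous hhom (by positivity)]
    simpa [partial₂] using euler_identity hsmooth hhom (v := (0, 1)) (by simp)
  refine ⟨torusOrbit hsmooth hhom p hp1 (Real.pi / F (1, 0)) (by positivity)
      (torusCurve_periodic (Or.inr ⟨1, by rw [hp₁]; push_cast; field_simp⟩)
        (Or.inl (by simp [hp]))),
    torusOrbit hsmooth hhom q hq1 (Real.pi / F (0, 1)) (by positivity)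
      (torusCurve_periodic (Or.inl (by simp [hq]))
        (Or.inr ⟨1, by rw [hq₂]; push_cast; field_simp⟩)), fun h => ?_⟩
  obtain ⟨t, ht⟩ : torusCurve (2 * partial₁ F (moment p)) (2 * partial₂ F (moment p)) p 0 ∈
      range (torusCurve (2 * partial₁ F (moment q)) (2 * partial₂ F (moment q)) q) :=
    h ▸ mem_range_self 0
  have h1 := congrArg moment ht
  rw [moment_torusCurve, moment_torusCurve, hmp, hmq] at h1
  have h2 := congrArg Prod.snd h1
  simp at h2
  exact hB.ne' h2

end Reinhardt

end

/-! ### The dichotomy: constant slope or slopes on both sides of the mean. -/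

theorem proposition1 (F : ℝ × ℝ → ℝ)
    (hsmooth : ContDiffOn ℝ ∞ F {0}ᶜ)
    (hpos : ∀ v : ℝ × ℝ, v ≠ 0 → 0 < F v)
    (hhom : ∀ (t : ℝ) (v : ℝ × ℝ), 0 < t → F (t • v) = t * F v) :
    (Reinhardt.rhoMinus (Reinhardt.toricFunction F) ≤ 1 ∧
        1 ≤ Reinhardt.rhoPlus (Reinhardt.toricFunction F)) ∧
      (Reinhardt.systolicNorm (Reinhardt.toricFunction F) = 0 ↔
        Reinhardt.IsEllipsoid (Reinhardt.domain (Reinhardt.toricFunction F))) := by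
  open Reinhardt in
  obtain ⟨hint, hvol⟩ := contactVolume_toricFunction hsmooth hpos hhom
  have hV := integral_slice_pos hpos hint
  have hA : 0 < F (1, 0) := hpos _ (by simp)
  set V := ∫ m in Set.Ioi (0 : ℝ), 1 / F (1, m) ^ 2 with hVdef
  -- The mean of the slope of `F (1, ·)` for the weight `1 / F (1, m)²`: a slope `c` corresponds to
  -- a pairing equal to `1`.
  set c : ℝ := 1 / F (1, 0) / V with hc
  have hcV : c * V = 1 / F (1, 0) := div_mul_cancel₀ _ hV.ne'
  have hlow : ∀ γ₁ γ₂ : PeriodicOrbit (toricFunction F), GeomDistinct γ₁ γ₂ →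
      rhoMinus (toricFunction F) ≤ (systolicPairing γ₁ γ₂ : EReal) :=
    fun γ₁ γ₂ h => iInf_le_of_le γ₁ (iInf₂_le γ₂ h)
  have hupp : ∀ γ₁ γ₂ : PeriodicOrbit (toricFunction F), GeomDistinct γ₁ γ₂ →
      (systolicPairing γ₁ γ₂ : EReal) ≤ rhoPlus (toricFunction F) :=
    fun γ₁ γ₂ h => le_iSup_of_le γ₁ (le_iSup₂_of_le γ₂ h le_rfl)
  rcases affine_or_exists_resonant (fun m => hasDerivAt_slice hsmooth m)
    (fun m => hpos (1, m) (by simp)) (differentiable_partial₂_slice hsmooth)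
    (tendsto_slice hsmooth hpos hhom) hint hcV with haff | ⟨⟨m, hm, hmc, hmr⟩, n, hn, hnc, hnr⟩
  · have hF := toricFunction_eq_ellipsoidFunction hsmooth hhom haff
    have hcpos : 0 < c := by positivity
    have hone : ∀ γ₁ γ₂ : PeriodicOrbit (toricFunction F), GeomDistinct γ₁ γ₂ →
        systolicPairing γ₁ γ₂ = 1 := by
      intro γ₁ γ₂ h
      rw [systolicPairing_ellipsoid hhom hF hvol γ₁ γ₂ h, mul_assoc, hcV]
      field_simp
    -- At least one pair is needed, since otherwise the infimum would be `⊤` and the supremum `⊥`.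
    obtain ⟨γ₁, γ₂, hγ⟩ := exists_geomDistinct hsmooth hpos hhom
    have hle := hlow γ₁ γ₂ hγ
    have hge := hupp γ₁ γ₂ hγ
    rw [hone γ₁ γ₂ hγ, EReal.coe_one] at hle hge
    have hminus : rhoMinus (toricFunction F) = 1 :=
      hle.antisymm <| le_iInf fun δ₁ => le_iInf₂ fun δ₂ h => by rw [hone δ₁ δ₂ h, EReal.coe_one]
    have hplus : rhoPlus (toricFunction F) = 1 :=
      le_antisymm (iSup_le fun δ₁ => iSup₂_le fun δ₂ h => by rw [hone δ₁ δ₂ h, EReal.coe_one]) hge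
    refine ⟨⟨hle, hge⟩, iff_of_true ?_ ?_⟩
    · rw [systolicNorm, hminus, hplus]
      exact EReal.sub_self (EReal.coe_ne_top 1) (EReal.coe_ne_bot 1)
    · rw [hF]
      exact isEllipsoid_ellipsoidFunction hA hcpos
  · have heul : ∀ x : ℝ, partial₁ F (1, x) = F (1, x) - x * partial₂ F (1, x) := fun x => by
      have := euler_identity hsmooth hhom (v := (1, x)) (by simp)
      simp only [one_mul] at this
      linarith
    rw [← heul] at hmr hnr
    have hAV : 0 < F (1, 0) * V := mul_pos hA hV
    have hmean : c * (F (1, 0) * V) = 1 := by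
      rw [mul_left_comm, hcV]; field_simp
    obtain ⟨γ₁, γ₂, hγ, hρ⟩ := exists_systolicPairing_eq hsmooth hpos hhom hvol hm hmr
    obtain ⟨δ₁, δ₂, hδ, hσ⟩ := exists_systolicPairing_eq hsmooth hpos hhom hvol hn hnr
    have hplus : 1 < rhoPlus (toricFunction F) := by
      refine lt_of_lt_of_le ?_ (hupp γ₁ γ₂ hγ)
      rw [hρ, ← EReal.coe_one, EReal.coe_lt_coe_iff, mul_assoc]
      exact hmean.symm.trans_lt (mul_lt_mul_of_pos_right hmc hAV)
    have hminus : rhoMinus (toricFunction F) < 1 := by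
      refine lt_of_le_of_lt (hlow δ₁ δ₂ hδ) ?_
      rw [hσ, ← EReal.coe_one, EReal.coe_lt_coe_iff, mul_assoc]
      exact (mul_lt_mul_of_pos_right hnc hAV).trans_eq hmean
    refine ⟨⟨hminus.le, hplus.le⟩, iff_of_false ?_ ?_⟩
    · exact (EReal.sub_pos.2 (hminus.trans hplus)).ne'
    -- On an ellipsoid the slope is the same at `m` and `n`, so it cannot lie strictly on both sides
    -- of `c`.
    · intro hW
      obtain ⟨k, hk⟩ := exists_slope_of_isEllipsoid hsmooth hpos hhom hW
      rw [hk m hm] at hmc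
      rw [hk n hn] at hnc
      exact lt_asymm hmc hnc
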